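/- There is a universal constant $C>0$ such that the following holds. Let $L\ge 1$, let $d_0,\dots,d_L$ and $m_1,\dots,m_L$ be dimensions, write $d=d_0$, $k=d_L\ge 2$, and $W=\max\{d_0,\dots,d_L,m_1,\dots,m_L\}$. Let $\sigma_i:\mathbb{R}^{m_i}\to\mathbb{R}^{d_i}$ be $\rho_i$-Lipschitz for the Euclidean norms with $\sigma_i(0)=0$, and let $M_i\in\mathbb{R}^{m_i\times d_{i-1}}$ be fixed reference matrices ($1\le i\le L$). For weights $\mathcal A=(A_1,\dots,A_L)$, $A_i\in\mathbb{R}^{m_i\times d_{i-1}}$, let $$F_{\mathcal A}(x)=\sigma_L(A_L\,\sigma_{L-1}(A_{L-1}\cdots\sigma_1(A_1x)\cdots)),\qquad x\in\mathbb{R}^d .$$ Write $\|\cdot\|_\sigma$ for the spectral norm, $\|B\|_{2,1}$ for the sum of the Euclidean norms of the columns of $B$, $a_i=\|A_i^\top-M_i^\top\|_{2,1}$, $s_i=\|A_i\|_\sigma$, and let $$R_{\mathcal A}=\Big(\prod_{i=1}^L\rho_i s_i\Big)\Big(\sum_{i=1}^L \frac{a_i^{2/3}}{s_i^{2/3}}\Big)^{3/2}$$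 be the spectral complexity. For $\gamma>0$ let $\ell_\gamma(r)=0$ for $r<-\gamma$, $\ell_\gamma(r)=1+r/\gamma$ for $-\gamma\le r\le 0$, $\ell_\gamma(r)=1$ for $r>0$. For a sample $((x_i,y_i))_{i=1}^n$ in $\mathbb{R}^d\times\{1,\dots,k\}$ put $\|X\|_2=(\sum_i\|x_i\|_2^2)^{1/2}$ and $$\widehat{\mathcal R}_\gamma(f)=\frac1n\sum_{i=1}^n\ell_\gamma\Big(\max_{j\ne y_i}f(x_i)_j-f(x_i)_{y_i}\Big).$$ Let $0<\delta<1$. (1) For every probability distribution on $\mathbb{R}^d\times\{1,\dots,k\}$ and every $n\ge 1$, with probability at least $1-\delta$ over an iid sample $((x_i,y_i))_{i=1}^n$, every $\gamma>0$ and every choice of weights $\mathcal A$ satisfy, for any rule of breaking ties in the $\arg\max$, $$\Pr\big[\arg\max_j F_{\mathcal A}(x)_j\ne y\big]\le\widehat{\mathcal R}_\gamma(F_{\mathcal A})+f(n,\gamma,X,\mathcal A),$$ where $(x,y)$ is a fresh draw and $$f=\frac8n+\frac{144\ln(n)\ln(2W)}{\gamma n}\Big(\prod_i\rho_i\Big)(1+\|X\|_2)\Big(\sum_{i=1}^L\Big(\big(\tfrac1L+a_i\big)\prod_{j\ne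 i}\big(\tfrac1L+s_j\big)\Big)^{2/3}\Big)^{3/2}$$ $$\qquad+\sqrt{\frac9{2n}}\sqrt{\ln\tfrac1\delta+\ln 2+\big|\ln\tfrac n\gamma\big|+2\ln(2+\|X\|_2)+2\sum_i\ln(2+La_i)+2\sum_i\ln(2+Ls_i)} .$$ (2) For every sample, every $\gamma>0$ and every $\mathcal A$, $$\widehat{\mathcal R}_\gamma(F_{\mathcal A})\le \frac1n\sum_{i=1}^n \mathbf 1\Big[F_{\mathcal A}(x_i)_{y_i}\le\gamma+\max_{j\ne y_i}F_{\mathcal A}(x_i)_j\Big].$$ (3) Suppose all $\rho_i>0$. Then $f=\widetilde{\mathcal O}(g)$, where $$g=\frac{\|X\|_2R_{\mathcal A}}{\gamma n}\ln(W)+\sqrt{\frac{\ln(1/\delta)}n},$$ in the following sense: with $L$, the dimensions, $\rho_i$, $M_i$ and $\delta$ fixed, along every sequence of tuples $(n,\gamma,X,\mathcal A)$ with $\gamma>0$, $n\to\infty$, $\|X\|_2\to\infty$ and $\|A_i\|_\sigma\to\infty$ for every $i$, one eventually has $$f\le C\,g\,\big(\ln n+|\ln\gamma|+\ln\|X\|_2+\ln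 R_{\mathcal A}\big).$$ -/

import Mathlib

open MeasureTheory Filter Topology

noncomputable section

namespace SpectralMargin

/-- Weight matrices of an `L`-layer network. Layer `i` multiplies by a matrix of size
`m i × d i.castSucc` and then applies a nonlinearity `ℝ^(m i) → ℝ^(d i.succ)`. -/
abbrev Weights {L : ℕ} (d : Fin (L + 1) → ℕ) (m : Fin L → ℕ) : Type :=
  ∀ i : Fin L, Matrix (Fin (m i)) (Fin (d i.castSucc)) ℝ

/-- Nonlinearities of an `L`-layer network, between Euclidean spaces. -/
abbrev Nonlinearities {L : ℕ} (d : Fin (L + 1) → ℕ) (m : Fin L → ℕ) : Type :=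
  ∀ i : Fin L, EuclideanSpace ℝ (Fin (m i)) → EuclideanSpace ℝ (Fin (d i.succ))

/-- The output of the first `i` layers on input `x`. -/
def layerOutput {L : ℕ} {d : Fin (L + 1) → ℕ} {m : Fin L → ℕ} (σ : Nonlinearities d m)
    (A : Weights d m) (x : EuclideanSpace ℝ (Fin (d 0))) :
    ∀ i : Fin (L + 1), EuclideanSpace ℝ (Fin (d i)) :=
  Fin.induction x (fun i z => σ i (WithLp.toLp 2 (Matrix.mulVec (A i) z)))

/-- The network `F_A(x) = σ_L (A_L σ_{L-1} (A_{L-1} ⋯ σ_1 (A_1 x) ⋯))`. -/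
def network {L : ℕ} {d : Fin (L + 1) → ℕ} {m : Fin L → ℕ} (σ : Nonlinearities d m)
    (A : Weights d m) (x : EuclideanSpace ℝ (Fin (d 0))) :
    EuclideanSpace ℝ (Fin (d (Fin.last L))) :=
  layerOutput σ A x (Fin.last L)

/-- The largest dimension of all the spaces that occur in the network. -/
def width {L : ℕ} (d : Fin (L + 1) → ℕ) (m : Fin L → ℕ) : ℕ :=
  max (Finset.univ.sup d) (Finset.univ.sup m)

open scoped Matrix.Norms.L2Operator in
/-- The spectral norm: the operator norm with respect to Euclidean norms. -/
def spectralNorm {p q : ℕ} (A : Matrix (Fin p) (Fin q) ℝ) : ℝ := ‖A‖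

/-- The `(2,1)` norm: the sum of the Euclidean norms of the columns. -/
def norm21 {p q : ℕ} (A : Matrix (Fin p) (Fin q) ℝ) : ℝ :=
  ∑ j, Real.sqrt (∑ i, A i j ^ 2)

/-- The entrywise `ℓ₂` norm of the matrix whose rows are the data points. -/
def dataNorm {n q : ℕ} (x : Fin n → EuclideanSpace ℝ (Fin q)) : ℝ :=
  Real.sqrt (∑ i, ‖x i‖ ^ 2)

/-- The margin operator `v_y - max_{j ≠ y} v_j` (used for at least two classes). -/
def margin {k : ℕ} (v : EuclideanSpace ℝ (Fin k)) (y : Fin k) : ℝ :=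
  v y - ⨆ j : {j : Fin k // j ≠ y}, v j

/-- The ramp loss. -/
def ramp (γ r : ℝ) : ℝ :=
  if r < -γ then 0 else if r ≤ 0 then 1 + r / γ else 1

/-- The empirical ramp risk of `f` on the sample `S`. -/
def empiricalRampRisk {n q k : ℕ} (γ : ℝ)
    (f : EuclideanSpace ℝ (Fin q) → EuclideanSpace ℝ (Fin k))
    (S : Fin n → EuclideanSpace ℝ (Fin q) × Fin k) : ℝ :=
  (n : ℝ)⁻¹ * ∑ i, ramp γ (-margin (f (S i).1) (S i).2)

open scoped Classical in
/-- The fraction of sample points with `f(x_i)_{y_i} ≤ γ + max_{j ≠ y_i} f(x_i)_j`. -/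
def empiricalMarginError {n q k : ℕ} (γ : ℝ)
    (f : EuclideanSpace ℝ (Fin q) → EuclideanSpace ℝ (Fin k))
    (S : Fin n → EuclideanSpace ℝ (Fin q) × Fin k) : ℝ :=
  (n : ℝ)⁻¹ * ∑ i, if f (S i).1 (S i).2 ≤ γ + ⨆ j : {j : Fin k // j ≠ (S i).2}, f (S i).1 j
    then 1 else 0

/-- The spectral complexity `R_A` relative to Lipschitz constants `ρ` and reference
matrices `M`. -/
def spectralComplexity {L : ℕ} {d : Fin (L + 1) → ℕ} {m : Fin L → ℕ} (ρ : Fin L → NNReal)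
    (M A : Weights d m) : ℝ :=
  (∏ i, (ρ i : ℝ) * spectralNorm (A i)) *
    (∑ i, norm21 ((A i).transpose - (M i).transpose) ^ (2 / 3 : ℝ) /
      spectralNorm (A i) ^ (2 / 3 : ℝ)) ^ (3 / 2 : ℝ)

/-- The explicit excess risk. `B` stands for the norm of the data. -/
def excess {L : ℕ} {d : Fin (L + 1) → ℕ} {m : Fin L → ℕ} (ρ : Fin L → NNReal)
    (M : Weights d m) (δ : ℝ) (n : ℕ) (γ B : ℝ) (A : Weights d m) : ℝ :=
  8 / n +
  144 * Real.log n * Real.log (2 * width d m) / (γ * n) * (∏ i, (ρ i : ℝ)) * (1 + B) *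
    (∑ i, ((1 / (L : ℝ) + norm21 ((A i).transpose - (M i).transpose)) *
      ∏ j ∈ Finset.univ.erase i, (1 / (L : ℝ) + spectralNorm (A j))) ^ (2 / 3 : ℝ)) ^
        (3 / 2 : ℝ) +
  Real.sqrt (9 / (2 * n)) *
    Real.sqrt (Real.log (1 / δ) + (Real.log 2 + |Real.log (n / γ)|) + 2 * Real.log (2 + B) +
      2 * ∑ i, Real.log (2 + L * norm21 ((A i).transpose - (M i).transpose)) +
      2 * ∑ i, Real.log (2 + L * spectralNorm (A i)))

/-- The leading-order rate `‖X‖₂ R_A ln(W) / (γ n) + √(ln(1/δ) / n)`. -/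
def rate {L : ℕ} {d : Fin (L + 1) → ℕ} {m : Fin L → ℕ} (ρ : Fin L → NNReal)
    (M : Weights d m) (δ : ℝ) (n : ℕ) (γ B : ℝ) (A : Weights d m) : ℝ :=
  B * spectralComplexity ρ M A / (γ * n) * Real.log (width d m) +
    Real.sqrt (Real.log (1 / δ) / n)

/-- The logarithmic factor: the sum of the logarithms of the varying quantities from which
`rate` is built. -/
def logFactor {L : ℕ} {d : Fin (L + 1) → ℕ} {m : Fin L → ℕ} (ρ : Fin L → NNReal)
    (M : Weights d m) (n : ℕ) (γ B : ℝ) (A : Weights d m) : ℝ :=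
  Real.log n + |Real.log γ| + Real.log B + Real.log (spectralComplexity ρ M A)

end SpectralMargin

end

/-!
The idea is that the bound costs only a logarithm more than covering the network outputs on the
sample. Maurey's empirical method approximates the outputs of one layer by averages of few signed
coordinates, so their metric entropy at scale `ε` is of order `(‖X‖ a / ε)² log (2 * W)`, where `a`
is the (2,1) distance to the reference matrix: the reference only translates the outputs. Covers of
the layers compose, an error made in layer `i` being amplified by the product of the later
`ρ_j s_j`; optimising the split of the total error among the layers produces the exponents `2/3` and
`3/2` while keeping an entropy of order `1 / ε²`, for which Dudley's chaining costs only `log n`.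

Symmetrization and McDiarmid's inequality turn this into a uniform deviation bound for margin,
data norm, distances and norms below prescribed values. The prescription is removed by a union
bound over a countable weighted grid, of step `1/L` in the distances and norms; this is where the
shifts `1/L` and the logarithms in the bound come from. As the spectral norms grow the shifts cost
at most a factor `(1 + 1/L)^L ≤ 3`, and the logarithms of the `a_i` and `s_i` are controlled by
`log R`.
-/

noncomputable section

namespace SpectralMargin

open ProbabilityTheory
open scoped NNReal BigOperators

/-! ### McDiarmid's inequality -/

section McDiarmid

lemma hasSubgaussianMGF_of_forall_sub_le {Ω : Type*} [MeasurableSpace Ω] {μ : Measure Ω}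
    [IsProbabilityMeasure μ] {f : Ω → ℝ} (hf : Measurable f) {c : ℝ≥0}
    (hc : ∀ x y, f x - f y ≤ c) :
    HasSubgaussianMGF (fun x => f x - ∫ y, f y ∂μ) ((c / 2) ^ 2) μ := by
  obtain ⟨x₀⟩ : Nonempty Ω := nonempty_of_isProbabilityMeasure μ
  have : Nonempty Ω := ⟨x₀⟩
  have hbdd : BddBelow (Set.range f) :=
    ⟨f x₀ - c, by rintro _ ⟨x, rfl⟩; linarith [hc x₀ x]⟩
  have hmem (x : Ω) : f x ∈ Set.Icc (⨅ y, f y) ((⨅ y, f y) + c) := by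
    refine ⟨ciInf_le hbdd x, ?_⟩
    linarith [le_ciInf fun y => sub_le_comm.1 (hc x y)]
  simpa using hasSubgaussianMGF_of_mem_Icc hf.aemeasurable (ae_of_all μ hmem)

lemma integrable_exp_of_abs_le {Ω : Type*} [MeasurableSpace Ω] {μ : Measure Ω}
    [IsFiniteMeasure μ] {f : Ω → ℝ} (hf : Measurable f) {b : ℝ} (hb : ∀ x, |f x| ≤ b) :
    Integrable (fun x => Real.exp (f x)) μ := by
  refine Integrable.of_bound (by fun_prop) (Real.exp b) (ae_of_all μ fun x => ?_)
  rw [Real.norm_of_nonneg (Real.exp_nonneg _), Real.exp_le_exp]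
  exact (le_abs_self _).trans (hb x)

/-- Exponential moments factor over the two variables: centre the inner variable first. -/
lemma hasSubgaussianMGF_prod {α β : Type*} [MeasurableSpace α] [MeasurableSpace β]
    {μ : Measure α} {ν : Measure β} [IsProbabilityMeasure μ] [IsProbabilityMeasure ν]
    {g : α × β → ℝ} (hg : Measurable g) {b : ℝ} (hb : ∀ p, |g p| ≤ b) {c₁ c₂ : ℝ≥0}
    (h₁ : ∀ y, HasSubgaussianMGF (fun x => g (x, y) - ∫ x, g (x, y) ∂μ) c₁ μ)
    (h₂ : HasSubgaussianMGF
      (fun y => ∫ x, g (x, y) ∂μ - ∫ y, ∫ x, g (x, y) ∂μ ∂ν) c₂ ν) :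
    HasSubgaussianMGF (fun p => g p - ∫ p, g p ∂μ.prod ν) (c₁ + c₂) (μ.prod ν) := by
  have hint : Integrable g (μ.prod ν) := .of_bound (by fun_prop) b (ae_of_all _ hb)
  have hexp (t : ℝ) : Integrable (fun p => Real.exp (t * (g p - ∫ p, g p ∂μ.prod ν)))
      (μ.prod ν) := by
    refine integrable_exp_of_abs_le (by fun_prop) (b := |t| * (b + |∫ p, g p ∂μ.prod ν|))
      fun p => ?_
    rw [abs_mul]
    gcongr
    exact (abs_sub _ _).trans (by gcongr; exact hb p)
  refine ⟨hexp, fun t => ?_⟩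
  rw [← integral_prod_symm g hint] at h₂
  set E := ∫ p, g p ∂μ.prod ν
  have hinner (y : β) : ∫ x, Real.exp (t * (g (x, y) - E)) ∂μ ≤
      Real.exp (c₁ * t ^ 2 / 2) * Real.exp (t * ((∫ x, g (x, y) ∂μ) - E)) := by
    have hsplit (x : α) : Real.exp (t * (g (x, y) - E)) =
        Real.exp (t * (g (x, y) - ∫ x, g (x, y) ∂μ)) *
          Real.exp (t * ((∫ x, g (x, y) ∂μ) - E)) := by
      rw [← Real.exp_add]; ring_nf
    simp_rw [hsplit, integral_mul_const]
    gcongr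
    exact (h₁ y).mgf_le t
  calc mgf (fun p => g p - E) (μ.prod ν) t
      = ∫ y, ∫ x, Real.exp (t * (g (x, y) - E)) ∂μ ∂ν :=
        integral_prod_symm _ (hexp t)
    _ ≤ ∫ y, Real.exp (c₁ * t ^ 2 / 2) * Real.exp (t * ((∫ x, g (x, y) ∂μ) - E)) ∂ν :=
        integral_mono (hexp t).integral_prod_right
          ((h₂.integrable_exp_mul t).const_mul _) hinner
    _ ≤ Real.exp (c₁ * t ^ 2 / 2) * Real.exp (c₂ * t ^ 2 / 2) := by
        rw [integral_const_mul]
        gcongr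
        exact h₂.mgf_le t
    _ = Real.exp ((c₁ + c₂ : ℝ≥0) * t ^ 2 / 2) := by
        rw [← Real.exp_add, NNReal.coe_add]; ring_nf

/-- The bounded differences property: changing the `k`-th variable changes `g` by at most
`c k`. -/
def BoundedDifferences {n : ℕ} {Z : Fin n → Type*} (g : (∀ k, Z k) → ℝ)
    (c : Fin n → ℝ≥0) : Prop :=
  ∀ S k z, |g (Function.update S k z) - g S| ≤ c k

lemma measurePreserving_cons {n : ℕ} {Z : Fin (n + 1) → Type*} [∀ k, MeasurableSpace (Z k)]
    (μ : ∀ k, Measure (Z k)) [∀ k, IsProbabilityMeasure (μ k)] :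
    MeasurePreserving (fun p : Z 0 × (∀ k : Fin n, Z k.succ) => (Fin.cons p.1 p.2 : ∀ k, Z k))
      ((μ 0).prod (Measure.pi fun k => μ k.succ)) (Measure.pi μ) := by
  have hcons : (fun p : Z 0 × (∀ k : Fin n, Z k.succ) => (Fin.cons p.1 p.2 : ∀ k, Z k)) =
      (MeasurableEquiv.piFinSuccAbove Z 0).symm :=
    funext fun p => (Fin.insertNth_zero p.1 p.2).symm
  rw [hcons]
  exact (measurePreserving_piFinSuccAbove μ 0).symm

namespace BoundedDifferences

variable {n : ℕ}

lemma cons_right {Z : Fin (n + 1) → Type*} {g : (∀ k, Z k) → ℝ} {c : Fin (n + 1) → ℝ≥0}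
    (hg : BoundedDifferences g c) (z : Z 0) :
    BoundedDifferences (fun S : ∀ k : Fin n, Z k.succ => g (Fin.cons z S))
      fun k => c k.succ := fun S k w => by
  simpa only [Fin.cons_update] using hg (Fin.cons z S) k.succ w

lemma abs_cons_sub_cons_le {Z : Fin (n + 1) → Type*} {g : (∀ k, Z k) → ℝ}
    {c : Fin (n + 1) → ℝ≥0} (hg : BoundedDifferences g c) (z w : Z 0)
    (S : ∀ k : Fin n, Z k.succ) : |g (Fin.cons z S) - g (Fin.cons w S)| ≤ c 0 := by
  simpa only [Fin.update_cons_zero] using hg (Fin.cons w S) 0 z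

lemma abs_sub_le : ∀ {n : ℕ} {Z : Fin n → Type*} {g : (∀ k, Z k) → ℝ} {c : Fin n → ℝ≥0},
    BoundedDifferences g c → ∀ S T, |g S - g T| ≤ ∑ k, (c k : ℝ)
  | 0, _, g, _, _, S, T => by simp [Subsingleton.elim S T]
  | n + 1, Z, g, c, hg, S, T => by
    rw [← Fin.cons_self_tail S, ← Fin.cons_self_tail T, Fin.sum_univ_succ]
    calc |g (Fin.cons (S 0) (Fin.tail S)) - g (Fin.cons (T 0) (Fin.tail T))|
        ≤ |g (Fin.cons (S 0) (Fin.tail S)) - g (Fin.cons (T 0) (Fin.tail S))| +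
          |g (Fin.cons (T 0) (Fin.tail S)) - g (Fin.cons (T 0) (Fin.tail T))| :=
          _root_.abs_sub_le _ _ _
      _ ≤ c 0 + ∑ k : Fin n, (c k.succ : ℝ) :=
          add_le_add (hg.abs_cons_sub_cons_le _ _ _) ((hg.cons_right _).abs_sub_le _ _)

lemma abs_le {Z : Fin n → Type*} {g : (∀ k, Z k) → ℝ} {c : Fin n → ℝ≥0}
    (hg : BoundedDifferences g c) (T : ∀ k, Z k) (S : ∀ k, Z k) :
    |g S| ≤ |g T| + ∑ k, (c k : ℝ) := by
  linarith [abs_sub_abs_le_abs_sub (g S) (g T), hg.abs_sub_le S T]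

lemma integral_cons_left {Z : Fin (n + 1) → Type*} [∀ k, MeasurableSpace (Z k)] {μ : Measure (Z 0)}
    [IsProbabilityMeasure μ] {g : (∀ k, Z k) → ℝ} {c : Fin (n + 1) → ℝ≥0}
    (hd : BoundedDifferences g c)
    (hg : ∀ S, Integrable (fun z => g (Fin.cons z S)) μ) :
    BoundedDifferences (fun S : ∀ k : Fin n, Z k.succ => ∫ z, g (Fin.cons z S) ∂μ)
      fun k => c k.succ := fun S k w => by
  rw [← integral_sub (hg _) (hg _)]
  simpa using norm_integral_le_of_norm_le_const (C := c k.succ)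
    (f := fun z => g (Fin.cons z (Function.update S k w)) - g (Fin.cons z S))
    (ae_of_all μ fun z => hd.cons_right z S k w)

lemma hasSubgaussianMGF : ∀ {n : ℕ} {Z : Fin n → Type*} [∀ k, MeasurableSpace (Z k)]
    {μ : ∀ k, Measure (Z k)} [∀ k, IsProbabilityMeasure (μ k)] {g : (∀ k, Z k) → ℝ}
    {c : Fin n → ℝ≥0}, BoundedDifferences g c → Measurable g →
    HasSubgaussianMGF (fun S => g S - ∫ T, g T ∂Measure.pi μ) (∑ k, (c k / 2) ^ 2)
      (Measure.pi μ)
  | 0, _, _, μ, _, g, _, _, _ => by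
    have hconst : g = fun _ => g default := funext fun S => by rw [Subsingleton.elim S default]
    rw [hconst]
    simp
  | n + 1, Z, _, μ, _, g, c, hd, hg => by
    obtain ⟨T⟩ : Nonempty (∀ k, Z k) := nonempty_of_isProbabilityMeasure (Measure.pi μ)
    have hcons := measurePreserving_cons μ
    have hgc : Measurable fun p : Z 0 × (∀ k : Fin n, Z k.succ) => g (Fin.cons p.1 p.2) :=
      hg.comp hcons.measurable
    have hslice (S : ∀ k : Fin n, Z k.succ) : Measurable fun z => g (Fin.cons z S) :=
      hgc.comp measurable_prodMk_right
    have hint (S : ∀ k : Fin n, Z k.succ) : Integrable (fun z => g (Fin.cons z S)) (μ 0) :=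
      .of_bound (hslice S).aestronglyMeasurable _ (ae_of_all _ fun z => hd.abs_le T _)
    have hprod := hasSubgaussianMGF_prod (μ := μ 0) (ν := Measure.pi fun k : Fin n => μ k.succ)
      hgc (fun p => hd.abs_le T _)
      (fun S => hasSubgaussianMGF_of_forall_sub_le (hslice S) fun z w =>
        (le_abs_self _).trans (hd.abs_cons_sub_cons_le z w S))
      ((hd.integral_cons_left hint).hasSubgaussianMGF
        hgc.stronglyMeasurable.integral_prod_left'.measurable)
    rw [Fin.sum_univ_succ, ← hcons.map_eq, integral_map hcons.aemeasurable hg.aestronglyMeasurable]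
    refine hprod.congr_identDistrib ⟨(hgc.sub_const _).aemeasurable,
      (hg.sub_const _).aemeasurable, ?_⟩
    rw [Measure.map_map (hg.sub_const _) hcons.measurable]
    rfl

end BoundedDifferences

end McDiarmid

/-! ### Symmetrization -/

lemma abs_ciSup_sub_ciSup_le {ι : Type*} [Finite ι] [Nonempty ι] {a b : ι → ℝ} {c : ℝ}
    (h : ∀ i, |a i - b i| ≤ c) : |(⨆ i, a i) - ⨆ i, b i| ≤ c := by
  have ha := (Set.finite_range a).bddAbove
  have hb := (Set.finite_range b).bddAbove
  refine abs_sub_le_iff.2 ⟨sub_le_iff_le_add.2 ?_, sub_le_iff_le_add.2 ?_⟩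
  · exact ciSup_le fun i => by linarith [le_ciSup hb i, (abs_le.1 (h i)).2]
  · exact ciSup_le fun i => by linarith [le_ciSup ha i, (abs_le.1 (h i)).1]

lemma abs_ciSup_le {ι : Type*} [Finite ι] [Nonempty ι] {a : ι → ℝ} {c : ℝ}
    (h : ∀ i, |a i| ≤ c) : |⨆ i, a i| ≤ c := by
  simpa using abs_ciSup_sub_ciSup_le (a := a) (b := fun _ => 0) (by simpa using h)

lemma abs_sum_le_card_mul {κ : Type*} [Fintype κ] {v : κ → ℝ} {b : ℝ} (h : ∀ k, |v k| ≤ b) :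
    |∑ k, v k| ≤ Fintype.card κ * b :=
  (Finset.abs_sum_le_sum_abs _ _).trans <|
    (Finset.sum_le_sum fun k _ => h k).trans (by simp)

lemma abs_unit_mul (u : ℤˣ) (x : ℝ) : |(u : ℤ) * x| = |x| := by
  rw [abs_mul, abs_unit_intCast, one_mul]

section RademacherAverage

variable {ι κ : Type*} [Fintype κ] [DecidableEq κ]

/-- The Rademacher average of a family of vectors: the mean over all sign patterns `ε` of the
largest correlation of a member of the family with `ε`. It is not divided by the number of
coordinates. -/
def rademacherAvg (v : ι → κ → ℝ) : ℝ :=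
  𝔼 ε : κ → ℤˣ, ⨆ i, ∑ k, (ε k : ℤ) * v i k

lemma abs_rademacherAvg_sub_le [Finite ι] [Nonempty ι] {v w : ι → κ → ℝ} {c : ℝ}
    (h : ∀ (ε : κ → ℤˣ) i, |∑ k, (ε k : ℤ) * v i k - ∑ k, (ε k : ℤ) * w i k| ≤ c) :
    |rademacherAvg v - rademacherAvg w| ≤ c := by
  rw [rademacherAvg, rademacherAvg, ← Finset.expect_sub_distrib]
  exact (Finset.abs_expect_le _ _).trans
    (Finset.expect_le Finset.univ_nonempty fun ε _ => abs_ciSup_sub_ciSup_le (h ε))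

lemma abs_rademacherAvg_le [Finite ι] [Nonempty ι] {v : ι → κ → ℝ} {b : ℝ}
    (h : ∀ i k, |v i k| ≤ b) : |rademacherAvg v| ≤ Fintype.card κ * b :=
  (Finset.abs_expect_le _ _).trans <| Finset.expect_le Finset.univ_nonempty fun _ _ =>
    abs_ciSup_le fun i => abs_sum_le_card_mul fun k => (abs_unit_mul _ _).trans_le (h i k)

lemma measurable_rademacherAvg [Countable ι] {α : Type*} [MeasurableSpace α]
    {v : ι → κ → α → ℝ} (hv : ∀ i k, Measurable (v i k)) :
    Measurable fun x => rademacherAvg fun i k => v i k x := by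
  simp only [rademacherAvg, Fintype.expect_eq_sum_div_card]
  fun_prop

end RademacherAverage

section Symmetrization

variable {ι κ Z : Type*} [Fintype κ]

/-- The largest deviation, over a class of functions, of the sum over the sample from its
mean. -/
def maxDeviation [MeasurableSpace Z] (μ : Measure Z) (f : ι → Z → ℝ) (S : κ → Z) : ℝ :=
  ⨆ i, ∑ k, (∫ z, f i z ∂μ - f i (S k))

/-- The largest difference, over a class of functions, between the signed sums over the two
halves of a sample of pairs. -/
def pairDeviation (f : ι → Z → ℝ) (ε : κ → ℤˣ) (w : κ → Z × Z) : ℝ :=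
  ⨆ i, ∑ k, (ε k : ℤ) * (f i (w k).2 - f i (w k).1)

lemma abs_pairDeviation_le [Finite ι] [Nonempty ι] {f : ι → Z → ℝ} {b : ℝ}
    (hb : ∀ i z, |f i z| ≤ b) (ε : κ → ℤˣ) (w : κ → Z × Z) :
    |pairDeviation f ε w| ≤ Fintype.card κ * (b + b) :=
  abs_ciSup_le fun i => abs_sum_le_card_mul fun _ =>
    (abs_unit_mul _ _).trans_le ((abs_sub _ _).trans (add_le_add (hb i _) (hb i _)))

lemma expect_pairDeviation_le [DecidableEq κ] [Finite ι] [Nonempty ι] (f : ι → Z → ℝ)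
    (w : κ → Z × Z) :
    𝔼 ε, pairDeviation f ε w ≤
      rademacherAvg (fun i k => f i (w k).2) + rademacherAvg (fun i k => f i (w k).1) := by
  have hneg : rademacherAvg (fun i k => f i (w k).1) =
      𝔼 ε : κ → ℤˣ, ⨆ i, ∑ k, ((-ε) k : ℤ) * f i (w k).1 :=
    (Fintype.expect_equiv (Equiv.neg _) _ _ fun _ => rfl).symm
  rw [hneg, rademacherAvg, ← Finset.expect_add_distrib]
  refine Finset.expect_le_expect fun ε _ => ciSup_le fun i => ?_
  have hbdd (a : ι → ℝ) : BddAbove (Set.range a) := (Set.finite_range a).bddAbove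
  calc ∑ k, (ε k : ℤ) * (f i (w k).2 - f i (w k).1)
      = ∑ k, (ε k : ℤ) * f i (w k).2 + ∑ k, ((-ε) k : ℤ) * f i (w k).1 := by
        rw [← Finset.sum_add_distrib]
        refine Finset.sum_congr rfl fun k _ => ?_
        rw [Pi.neg_apply, Units.val_neg, Int.cast_neg]
        ring
    _ ≤ _ := add_le_add (le_ciSup (hbdd fun i => ∑ k, (ε k : ℤ) * f i (w k).2) i)
        (le_ciSup (hbdd fun i => ∑ k, ((-ε) k : ℤ) * f i (w k).1) i)

variable [MeasurableSpace Z]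

lemma measurable_maxDeviation [Countable ι] (μ : Measure Z) {f : ι → Z → ℝ}
    (hf : ∀ i, Measurable (f i)) : Measurable fun S : κ → Z => maxDeviation μ f S := by
  unfold maxDeviation
  fun_prop

lemma measurable_pairDeviation [Countable ι] {f : ι → Z → ℝ} (hf : ∀ i, Measurable (f i))
    (ε : κ → ℤˣ) : Measurable (pairDeviation f ε) := by
  unfold pairDeviation
  fun_prop

variable {f : ι → Z → ℝ} {b : ℝ}

lemma abs_maxDeviation_le [Finite ι] [Nonempty ι] (μ : Measure Z) [IsProbabilityMeasure μ]
    (hb : ∀ i z, |f i z| ≤ b) (S : κ → Z) :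
    |maxDeviation μ f S| ≤ Fintype.card κ * (b + b) := by
  refine abs_ciSup_le fun i => abs_sum_le_card_mul fun k => ?_
  refine (abs_sub _ _).trans (add_le_add ?_ (hb i _))
  simpa using norm_integral_le_of_norm_le_const (μ := μ) (f := f i) (C := b)
    (ae_of_all μ fun z => hb i z)

lemma integrable_pairDeviation [Finite ι] [Nonempty ι] {P : Measure (κ → Z × Z)}
    [IsFiniteMeasure P] (hf : ∀ i, Measurable (f i)) (hb : ∀ i z, |f i z| ≤ b) (ε : κ → ℤˣ) :
    Integrable (pairDeviation f ε) P :=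
  .of_bound (measurable_pairDeviation hf ε).aestronglyMeasurable _
    (ae_of_all _ (abs_pairDeviation_le hb ε))

variable (μ : Measure Z) [IsProbabilityMeasure μ]

lemma measurePreserving_zip :
    MeasurePreserving (fun (p : (κ → Z) × (κ → Z)) k => (p.1 k, p.2 k))
      ((Measure.pi fun _ => μ).prod (Measure.pi fun _ => μ)) (Measure.pi fun _ => μ.prod μ) :=
  (measurePreserving_arrowProdEquivProdArrow Z Z κ (fun _ => μ) (fun _ => μ)).symm

/-- Jensen's inequality: the mean in `maxDeviation` is the average of the sum over an independent
ghost sample. -/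
lemma maxDeviation_le_integral [Finite ι] [Nonempty ι] (hf : ∀ i, Measurable (f i))
    (hb : ∀ i z, |f i z| ≤ b) (S : κ → Z) :
    maxDeviation μ f S ≤
      ∫ T, pairDeviation f 1 (fun k => (S k, T k)) ∂(Measure.pi fun _ => μ) := by
  refine ciSup_le fun i => ?_
  have hint (k : κ) : Integrable (fun T : κ → Z => f i (T k)) (Measure.pi fun _ => μ) :=
    .of_bound ((hf i).comp (measurable_pi_apply k)).aestronglyMeasurable b
      (ae_of_all _ fun T => hb i (T k))
  have hmean : ∑ k, (∫ z, f i z ∂μ - f i (S k)) =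
      ∫ T, ∑ k, (f i (T k) - f i (S k)) ∂(Measure.pi fun _ => μ) := by
    rw [integral_finsetSum Finset.univ (f := fun k (T : κ → Z) => f i (T k) - f i (S k))
      fun k _ => (hint k).sub (integrable_const _)]
    refine Finset.sum_congr rfl fun k _ => ?_
    rw [integral_sub (hint k) (integrable_const _), integral_const, probReal_univ, one_smul,
      integral_comp_eval (hf i).aestronglyMeasurable]
  rw [hmean]
  refine integral_mono (integrable_finsetSum _ fun k _ => (hint k).sub (integrable_const _))
    (.of_bound ?_ _ (ae_of_all _ fun T => abs_pairDeviation_le hb 1 _)) fun T => ?_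
  · exact ((measurable_pairDeviation hf 1).comp (by fun_prop)).aestronglyMeasurable
  · simpa [pairDeviation] using le_ciSup
      (f := fun i => ∑ k, (((1 : κ → ℤˣ) k : ℤ) : ℝ) * (f i (T k) - f i (S k)))
      (Set.finite_range _).bddAbove i

/-- Flipping a sign exchanges the two entries of an exchangeable pair. -/
lemma integral_pairDeviation [Countable ι] (hf : ∀ i, Measurable (f i)) (ε : κ → ℤˣ) :
    ∫ w, pairDeviation f ε w ∂(Measure.pi fun _ : κ => μ.prod μ) =
      ∫ w, pairDeviation f 1 w ∂(Measure.pi fun _ : κ => μ.prod μ) := by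
  have hswap : MeasurePreserving
      (fun (w : κ → Z × Z) k => (if ε k = 1 then id else Prod.swap) (w k))
      (Measure.pi fun _ => μ.prod μ) (Measure.pi fun _ : κ => μ.prod μ) := by
    refine measurePreserving_pi _ _ fun k => ?_
    split_ifs
    exacts [.id _, Measure.measurePreserving_swap]
  rw [← hswap.map_eq, integral_map hswap.aemeasurable
    (measurable_pairDeviation hf 1).aestronglyMeasurable, hswap.map_eq]
  refine integral_congr_ae (ae_of_all _ fun w => ?_)
  refine iSup_congr fun i => Finset.sum_congr rfl fun k _ => ?_
  rcases Int.units_eq_one_or (ε k) with h | h <;> simp [h]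

variable [DecidableEq κ] [Finite ι] [Nonempty ι]

lemma integrable_rademacherAvg (hf : ∀ i, Measurable (f i)) (hb : ∀ i z, |f i z| ≤ b) :
    Integrable (fun S : κ → Z => rademacherAvg fun i k => f i (S k)) (Measure.pi fun _ => μ) :=
  .of_bound (measurable_rademacherAvg fun i k => by fun_prop).aestronglyMeasurable _
    (ae_of_all _ fun _ => abs_rademacherAvg_le fun i _ => hb i _)

lemma integral_maxDeviation_le (hf : ∀ i, Measurable (f i)) (hb : ∀ i z, |f i z| ≤ b) :
    ∫ S : κ → Z, maxDeviation μ f S ∂(Measure.pi fun _ => μ) ≤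
      2 * ∫ S : κ → Z, rademacherAvg (fun i k => f i (S k)) ∂(Measure.pi fun _ => μ) := by
  set P : Measure (κ → Z) := Measure.pi fun _ => μ
  set PP : Measure (κ → Z × Z) := Measure.pi fun _ => μ.prod μ
  have hzip : MeasurePreserving _ (P.prod P) PP := measurePreserving_zip μ
  have hpair (ε : κ → ℤˣ) : Integrable (pairDeviation f ε) PP :=
    integrable_pairDeviation hf hb ε
  have hrad := integrable_rademacherAvg (κ := κ) μ hf hb
  have hproj {φ : Z × Z → Z} (hφ : MeasurePreserving φ (μ.prod μ) μ) :
      MeasurePreserving (fun (w : κ → Z × Z) k => φ (w k)) PP P :=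
    measurePreserving_pi _ _ fun _ => hφ
  have hfst := hproj measurePreserving_fst
  have hsnd := hproj measurePreserving_snd
  have hfst_int : Integrable (fun w => rademacherAvg fun i k => f i (w k).1) PP :=
    hfst.integrable_comp_of_integrable hrad
  have hsnd_int : Integrable (fun w => rademacherAvg fun i k => f i (w k).2) PP :=
    hsnd.integrable_comp_of_integrable hrad
  calc ∫ S, maxDeviation μ f S ∂P
      ≤ ∫ S, ∫ T, pairDeviation f 1 (fun k => (S k, T k)) ∂P ∂P :=
        integral_mono (.of_bound (measurable_maxDeviation μ hf).aestronglyMeasurable _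
          (ae_of_all _ (abs_maxDeviation_le μ hb)))
          (hzip.integrable_comp_of_integrable (hpair 1)).integral_prod_left
          (maxDeviation_le_integral μ hf hb)
    _ = ∫ w, pairDeviation f 1 w ∂PP := by
        rw [← hzip.map_eq, integral_map hzip.aemeasurable
          (measurable_pairDeviation hf 1).aestronglyMeasurable]
        exact (integral_prod _ (hzip.integrable_comp_of_integrable (hpair 1))).symm
    _ = ∫ w, 𝔼 ε, pairDeviation f ε w ∂PP := by
        simp_rw [Fintype.expect_eq_sum_div_card, integral_div,
          integral_finsetSum _ fun ε _ => hpair ε, PP, integral_pairDeviation μ hf]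
        rw [← Fintype.expect_eq_sum_div_card, Fintype.expect_const]
    _ ≤ ∫ w, (rademacherAvg (fun i k => f i (w k).2) +
          rademacherAvg (fun i k => f i (w k).1)) ∂PP := by
        refine integral_mono ?_ (hsnd_int.add hfst_int) (expect_pairDeviation_le f)
        simp_rw [Fintype.expect_eq_sum_div_card]
        exact (integrable_finsetSum _ fun ε _ => hpair ε).div_const _
    _ = 2 * ∫ S, rademacherAvg (fun i k => f i (S k)) ∂P := by
        have hpush {φ : (κ → Z × Z) → κ → Z} (hφ : MeasurePreserving φ PP P) :
            ∫ w, rademacherAvg (fun i k => f i (φ w k)) ∂PP =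
              ∫ S, rademacherAvg (fun i k => f i (S k)) ∂P := by
          rw [← hφ.map_eq, integral_map hφ.aemeasurable (by rw [hφ.map_eq]; exact hrad.1)]
        rw [integral_add hsnd_int hfst_int, hpush hsnd, hpush hfst, two_mul]

end Symmetrization

section UniformDeviation

variable {n : ℕ} {ι Z : Type*} [Finite ι] [Nonempty ι] {f : ι → Z → ℝ}

lemma BoundedDifferences.sub {Z : Fin n → Type*} {g h : (∀ k, Z k) → ℝ} {c c' : Fin n → ℝ≥0}
    (hg : BoundedDifferences g c) (hh : BoundedDifferences h c') :
    BoundedDifferences (fun S => g S - h S) fun k => c k + c' k := fun S k z => by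
  rw [NNReal.coe_add, sub_sub_sub_comm]
  exact (abs_sub _ _).trans (add_le_add (hg S k z) (hh S k z))

lemma BoundedDifferences.const_mul {Z : Fin n → Type*} {g : (∀ k, Z k) → ℝ} {c : Fin n → ℝ≥0}
    (hg : BoundedDifferences g c) (a : ℝ≥0) :
    BoundedDifferences (fun S => a * g S) fun k => a * c k := fun S k z => by
  rw [NNReal.coe_mul, ← mul_sub, abs_mul, NNReal.abs_eq]
  exact mul_le_mul_of_nonneg_left (hg S k z) a.2

lemma sum_update_sub_sum (φ : Fin n → Z → ℝ) (S : Fin n → Z) (j : Fin n) (z : Z) :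
    ∑ k, φ k (Function.update S j z k) - ∑ k, φ k (S k) = φ j z - φ j (S j) := by
  rw [← Finset.sum_sub_distrib, Finset.sum_eq_single j (fun k _ hk => by simp [hk]) (by simp)]
  simp

lemma boundedDifferences_maxDeviation [MeasurableSpace Z] (μ : Measure Z) {c : ℝ≥0}
    (hc : ∀ i z w, |f i z - f i w| ≤ c) :
    BoundedDifferences (fun S : Fin n → Z => maxDeviation μ f S) fun _ => c := fun S j z => by
  refine abs_ciSup_sub_ciSup_le fun i => ?_
  rw [sum_update_sub_sum fun _ z => ∫ z, f i z ∂μ - f i z, sub_sub_sub_cancel_left]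
  exact hc i _ _

lemma boundedDifferences_rademacherAvg {c : ℝ≥0} (hc : ∀ i z w, |f i z - f i w| ≤ c) :
    BoundedDifferences (fun S : Fin n → Z => rademacherAvg fun i k => f i (S k)) fun _ => c :=
  fun S j z => by
  refine abs_rademacherAvg_sub_le fun ε i => ?_
  rw [sum_update_sub_sum fun k z => (ε k : ℤ) * f i z, ← mul_sub, abs_unit_mul]
  exact hc i _ _

variable [MeasurableSpace Z] (μ : Measure Z) [IsProbabilityMeasure μ]

lemma measureReal_le_maxDeviation_sub_le (hf : ∀ i, Measurable (f i))
    (h01 : ∀ i z, f i z ∈ Set.Icc 0 1) {u : ℝ} (hu : 0 ≤ u) :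
    (Measure.pi fun _ : Fin n => μ).real
        {S | u ≤ maxDeviation μ f S - 2 * rademacherAvg (fun i k => f i (S k))} ≤
      Real.exp (-(2 * u ^ 2 / (9 * n))) := by
  have habs (i : ι) (z : Z) : |f i z| ≤ 1 :=
    abs_le.2 ⟨by linarith [(h01 i z).1], (h01 i z).2⟩
  have hdiff (i : ι) (z w : Z) : |f i z - f i w| ≤ (1 : ℝ≥0) := by
    simpa using abs_sub_le_of_nonneg_of_le (h01 i z).1 (h01 i z).2 (h01 i w).1 (h01 i w).2
  set P := Measure.pi fun _ : Fin n => μ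
  set g : (Fin n → Z) → ℝ := fun S =>
    maxDeviation μ f S - 2 * rademacherAvg (fun i k => f i (S k)) with hg
  have hDm := measurable_maxDeviation (κ := Fin n) μ hf
  have hRm : Measurable fun S : Fin n → Z => rademacherAvg fun i k => f i (S k) :=
    measurable_rademacherAvg fun i k => by fun_prop
  have hbd : BoundedDifferences g fun _ => 1 + 2 * 1 :=
    (boundedDifferences_maxDeviation μ hdiff).sub
      ((boundedDifferences_rademacherAvg hdiff).const_mul 2)
  have hmean : ∫ S, g S ∂P ≤ 0 := by
    rw [hg, integral_sub (.of_bound hDm.aestronglyMeasurable _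
      (ae_of_all _ (abs_maxDeviation_le μ habs)))
      ((integrable_rademacherAvg μ hf habs).const_mul 2), integral_const_mul]
    linarith [integral_maxDeviation_le (κ := Fin n) μ hf habs]
  calc P.real {S | u ≤ g S} ≤ P.real {S | u ≤ g S - ∫ T, g T ∂P} :=
        measureReal_mono fun S (hS : u ≤ g S) => show u ≤ _ by linarith
    _ ≤ _ := (hbd.hasSubgaussianMGF (hDm.sub (hRm.const_mul 2))).measure_ge_le hu
    _ = Real.exp (-(2 * u ^ 2 / (9 * n))) := by
        simp only [Finset.sum_const, Finset.card_univ, Fintype.card_fin]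
        rw [← mul_div_mul_left (2 * u ^ 2) (9 * n : ℝ) (two_ne_zero' ℝ)]
        push_cast
        congr 1
        ring

lemma measure_exists_deviation_le (hf : ∀ i, Measurable (f i))
    (h01 : ∀ i z, f i z ∈ Set.Icc 0 1) (hn : 0 < n) {t : ℝ} (ht : 0 ≤ t) :
    (Measure.pi fun _ : Fin n => μ) {S | ∃ i, (n : ℝ)⁻¹ * ∑ k, f i (S k) +
        2 / n * rademacherAvg (fun i k => f i (S k)) + t < ∫ z, f i z ∂μ} ≤
      ENNReal.ofReal (Real.exp (-(2 * n * t ^ 2 / 9))) := by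
  have hn' : (0 : ℝ) < n := Nat.cast_pos.2 hn
  refine (ENNReal.le_ofReal_iff_toReal_le (measure_ne_top _ _) (Real.exp_nonneg _)).2 ?_
  refine (measureReal_mono ?_).trans <|
    (measureReal_le_maxDeviation_sub_le μ hf h01 (mul_nonneg hn'.le ht)).trans_eq ?_
  · rintro S ⟨i, hi⟩
    have hmax : n * ∫ z, f i z ∂μ - ∑ k, f i (S k) ≤ maxDeviation μ f S := by
      simpa [maxDeviation] using le_ciSup (f := fun i => ∑ k, (∫ z, f i z ∂μ - f i (S k)))
        (Set.finite_range _).bddAbove i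
    have hscale := mul_lt_mul_of_pos_left hi hn'
    field_simp at hscale
    change n * t ≤ maxDeviation μ f S - 2 * rademacherAvg _
    linarith
  · congr 1
    field_simp

end UniformDeviation

/-! ### Maurey's covering lemma -/

section Maurey

variable {E : Type*} [NormedAddCommGroup E] [InnerProductSpace ℝ E]

lemma exists_norm_add_sub_sq_le {T : Set E} {b : ℝ} (hT : ∀ v ∈ T, ‖v‖ ≤ b) {y : E}
    (hy : y ∈ convexHull ℝ T) (S : E) : ∃ v ∈ T, ‖S + (v - y)‖ ^ 2 ≤ ‖S‖ ^ 2 + b ^ 2 := by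
  obtain ⟨v, hv, hvy⟩ := ((innerSL ℝ (S - y)).toLinearMap.concaveOn convex_univ)
    |>.exists_le_of_mem_convexHull (Set.subset_univ T) hy
  have hinner : inner ℝ (S - y) v ≤ inner ℝ (S - y) y := hvy
  have hvb : ‖v‖ ^ 2 ≤ b ^ 2 := pow_le_pow_left₀ (norm_nonneg v) (hT v hv) 2
  have hS : ‖S‖ ^ 2 = ‖S - y‖ ^ 2 + 2 * inner ℝ (S - y) y + ‖y‖ ^ 2 := by
    rw [← norm_add_sq_real, sub_add_cancel]
  refine ⟨v, hv, ?_⟩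
  rw [add_sub_left_comm, add_comm, norm_add_sq_real]
  linarith [sq_nonneg ‖y‖]

/-- The empirical method of Maurey: choosing the vectors greedily, each step increases the
squared error of the sum by at most `b ^ 2`. -/
lemma exists_norm_sum_sub_sq_le {T : Set E} {b : ℝ} (hT : ∀ v ∈ T, ‖v‖ ≤ b) {y : E}
    (hy : y ∈ convexHull ℝ T) (k : ℕ) :
    ∃ s : Fin k → T, ‖∑ j, (s j : E) - (k : ℝ) • y‖ ^ 2 ≤ k * b ^ 2 := by
  induction k with
  | zero => exact ⟨Fin.elim0, by simp⟩
  | succ k ih =>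
    obtain ⟨s, hs⟩ := ih
    obtain ⟨v, hv, hvS⟩ := exists_norm_add_sub_sq_le hT hy (∑ j, (s j : E) - (k : ℝ) • y)
    refine ⟨Fin.snoc (α := fun _ => T) s ⟨v, hv⟩, ?_⟩
    rw [Fin.sum_univ_castSucc]
    simp only [Fin.snoc_castSucc, Fin.snoc_last]
    rw [Nat.cast_succ, add_smul, one_smul, add_sub_add_comm]
    linarith

lemma exists_norm_sub_average_le {T : Set E} {b : ℝ} (hb : 0 ≤ b) (hT : ∀ v ∈ T, ‖v‖ ≤ b)
    {y : E} (hy : y ∈ convexHull ℝ T) {k : ℕ} (hk : 0 < k) :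
    ∃ s : Fin k → T, ‖y - (k : ℝ)⁻¹ • ∑ j, (s j : E)‖ ≤ b / √k := by
  obtain ⟨s, hs⟩ := exists_norm_sum_sub_sq_le hT hy k
  have hk' : (0 : ℝ) < k := Nat.cast_pos.2 hk
  refine ⟨s, ?_⟩
  have hscale : y - (k : ℝ)⁻¹ • ∑ j, (s j : E) =
      -((k : ℝ)⁻¹ • (∑ j, (s j : E) - (k : ℝ) • y)) := by
    rw [smul_sub, inv_smul_smul₀ hk'.ne', neg_sub]
  calc ‖y - (k : ℝ)⁻¹ • ∑ j, (s j : E)‖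
      = (k : ℝ)⁻¹ * ‖∑ j, (s j : E) - (k : ℝ) • y‖ := by
        rw [hscale, norm_neg, norm_smul, norm_inv, Real.norm_of_nonneg hk'.le]
    _ ≤ (k : ℝ)⁻¹ * (√k * b) := by
        gcongr
        rw [← Real.sqrt_sq hb, ← Real.sqrt_mul hk'.le]
        exact Real.le_sqrt_of_sq_le hs
    _ = b / √k := by
        rw [← mul_assoc, inv_mul_eq_div, Real.sqrt_div_self, inv_mul_eq_div]

lemma norm_le_of_mem_convexHull {T : Set E} {b : ℝ} (hT : ∀ v ∈ T, ‖v‖ ≤ b) {y : E}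
    (hy : y ∈ convexHull ℝ T) : ‖y‖ ≤ b := by
  simpa using convexHull_min (fun v hv => mem_closedBall_zero_iff.2 (hT v hv))
    (convex_closedBall (0 : E) b) hy

lemma log_card_image_fun_le {ι α : Type*} [Fintype ι] [DecidableEq α] {k : ℕ} {N : ℝ}
    (hN : 1 ≤ N) (hι : Fintype.card ι ≤ N) (f : (Fin k → ι) → α) :
    Real.log (Finset.univ.image f).card ≤ k * Real.log N := by
  rw [← Real.log_pow]
  rcases (Finset.univ.image f).card.eq_zero_or_pos with h | h
  · simpa [h] using Real.log_nonneg (one_le_pow₀ hN)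
  · refine Real.log_le_log (Nat.cast_pos.2 h) ?_
    calc ((Finset.univ.image f).card : ℝ) ≤ (Fintype.card ι : ℝ) ^ k := by
          exact_mod_cast Finset.card_image_le.trans_eq (by simp)
      _ ≤ N ^ k := by gcongr

lemma exists_cover_convexHull (T : Finset E) {b x N : ℝ} (hb : 0 ≤ b)
    (hT : ∀ v ∈ T, ‖v‖ ≤ b) (hx : 0 < x) (hN : 1 ≤ N) (hTN : T.card ≤ N) :
    ∃ C : Finset E, Real.log C.card ≤ 2 * x * Real.log N ∧
      ∀ y ∈ convexHull ℝ (T : Set E), ∃ c ∈ C, ‖y - c‖ ≤ b / √x := by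
  classical
  have hlog : 0 ≤ Real.log N := Real.log_nonneg hN
  have hsqrt : 0 < √x := Real.sqrt_pos.2 hx
  rcases lt_or_ge x 1 with hx1 | hx1
  · refine ⟨{0}, by simpa using by positivity, fun y hy => ⟨0, by simp, ?_⟩⟩
    rw [sub_zero, le_div_iff₀ hsqrt]
    exact (mul_le_of_le_one_right (norm_nonneg y) (Real.sqrt_le_one.2 hx1.le)).trans
      (norm_le_of_mem_convexHull hT hy)
  · refine ⟨Finset.univ.image fun s : Fin ⌈x⌉₊ → T => (⌈x⌉₊ : ℝ)⁻¹ • ∑ j, (s j : E), ?_,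
      fun y hy => ?_⟩
    · refine (log_card_image_fun_le hN (by simpa using hTN) _).trans ?_
      gcongr
      linarith [Nat.ceil_lt_add_one hx.le]
    · obtain ⟨s, hs⟩ := exists_norm_sub_average_le hb hT hy (Nat.ceil_pos.2 hx)
      refine ⟨_, Finset.mem_image_of_mem _ (Finset.mem_univ s), hs.trans ?_⟩
      gcongr
      exact Nat.le_ceil x

lemma exists_projection {K : Set E} (hne : K.Nonempty) (hcomplete : IsComplete K)
    (hconv : Convex ℝ K) (c : E) : ∃ v ∈ K, ∀ y ∈ K, ‖y - v‖ ≤ ‖y - c‖ := by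
  obtain ⟨v, hv, hmin⟩ := exists_norm_eq_iInf_of_complete_convex hne hcomplete hconv c
  refine ⟨v, hv, fun y hy => ?_⟩
  have hinner : inner ℝ (c - v) (y - v) ≤ 0 :=
    (norm_eq_iInf_iff_real_inner_le_zero hconv hv).1 hmin y hy
  have hsq : ‖y - c‖ ^ 2 = ‖y - v‖ ^ 2 - 2 * inner ℝ (c - v) (y - v) + ‖c - v‖ ^ 2 := by
    rw [← sub_sub_sub_cancel_right y c v, norm_sub_sq_real, real_inner_comm]
  refine le_of_sq_le_sq ?_ (norm_nonneg _)
  linarith [sq_nonneg ‖c - v‖]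

lemma log_card_image_le_log_card {α β : Type*} [DecidableEq β] (g : α → β) (C : Finset α) :
    Real.log (C.image g).card ≤ Real.log C.card := by
  rcases C.eq_empty_or_nonempty with rfl | hC
  · simp
  · have hcard : (C.image g).card ≤ C.card := Finset.card_image_le
    have : 0 < (C.image g).card := (hC.image g).card_pos
    gcongr

lemma exists_finset_projection {K : Set E} (hne : K.Nonempty) (hcomplete : IsComplete K)
    (hconv : Convex ℝ K) (C : Finset E) :
    ∃ C' : Finset E, Real.log C'.card ≤ Real.log C.card ∧ (∀ v ∈ C', v ∈ K) ∧
      ∀ c ∈ C, ∃ v ∈ C', ∀ y ∈ K, ‖y - v‖ ≤ ‖y - c‖ := by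
  classical
  choose P hPK hP using exists_projection hne hcomplete hconv
  exact ⟨C.image P, log_card_image_le_log_card P C, by simp [hPK],
    fun c hc => ⟨P c, Finset.mem_image_of_mem P hc, hP c⟩⟩

/-- The mass `1 - ∑ i, |w i|` that the coefficients leave over is spread evenly over all signed
vectors, where it cancels. -/
lemma sum_smul_mem_convexHull {V κ : Type*} [AddCommGroup V] [Module ℝ V] [Fintype κ]
    [Nonempty κ] (e : κ → V) {w : κ → ℝ} (hw : ∑ i, |w i| ≤ 1) :
    ∑ i, w i • e i ∈
      convexHull ℝ (Set.range fun q : κ × ℤˣ => ((q.2 : ℤ) : ℝ) • e q.1) := by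
  set r := (1 - ∑ i, |w i|) / (2 * Fintype.card κ) with hr
  have hr0 : 0 ≤ r := div_nonneg (sub_nonneg.2 hw) (by positivity)
  let p (q : κ × ℤˣ) : ℝ := (|w q.1| + (q.2 : ℤ) * w q.1) / 2 + r
  have hp (q : κ × ℤˣ) : 0 ≤ p q := by
    have := neg_abs_le (((q.2 : ℤ) : ℝ) * w q.1)
    rw [abs_unit_mul] at this
    exact add_nonneg (by linarith) hr0
  have hsum : ∑ q, p q = 1 := by
    have hpair (i : κ) : ∑ u : ℤˣ, p (i, u) = |w i| + 2 * r := by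
      simp only [UnitsInt.univ, Finset.mem_singleton, units_ne_neg_self, not_false_eq_true,
        Finset.sum_insert, Finset.sum_singleton, Units.val_one, Units.val_neg, Int.cast_one,
        Int.cast_neg, one_mul, p]
      ring
    simp_rw [Fintype.sum_prod_type, hpair, Finset.sum_add_distrib, Finset.sum_const,
      Finset.card_univ, nsmul_eq_mul, hr]
    field_simp
    ring
  have hcomb : ∑ q, p q • ((q.2 : ℤ) : ℝ) • e q.1 = ∑ i, w i • e i := by
    rw [Fintype.sum_prod_type]
    refine Finset.sum_congr rfl fun i _ => ?_
    simp only [UnitsInt.univ, Finset.mem_singleton, units_ne_neg_self, not_false_eq_true,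
      Finset.sum_insert, Finset.sum_singleton, Units.val_one, Units.val_neg, Int.cast_one,
      Int.cast_neg, one_mul, p]
    module
  rw [← hcomb]
  exact (convex_convexHull ℝ _).sum_mem (fun q _ => hp q) hsum
    fun q _ => subset_convexHull ℝ _ (Set.mem_range_self q)

lemma exists_cover_absConvex {κ : Type*} [Fintype κ] {e : κ → E} (he : ∀ i, ‖e i‖ ≤ 1)
    {g x N : ℝ} (hg : 0 ≤ g) (hx : 0 < x) (hN : 1 ≤ N) (hκ : 2 * (Fintype.card κ : ℝ) ≤ N) :
    ∃ C : Finset E, Real.log C.card ≤ 2 * x * Real.log N ∧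
      ∀ w : κ → ℝ, ∑ i, |w i| ≤ g → ∃ c ∈ C, ‖∑ i, w i • e i - c‖ ≤ g / √x := by
  classical
  have hlog : 0 ≤ Real.log N := Real.log_nonneg hN
  rcases isEmpty_or_nonempty κ with hempty | hne
  · exact ⟨{0}, by simpa using by positivity, fun w _ => ⟨0, by simp, by
      simp only [Finset.univ_eq_empty, Finset.sum_empty, sub_self, norm_zero]
      positivity⟩⟩
  set T : Finset E := Finset.univ.image fun q : κ × ℤˣ => ((q.2 : ℤ) : ℝ) • g • e q.1 with hTdef
  have hT : ∀ v ∈ T, ‖v‖ ≤ g := by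
    simp only [hTdef, Finset.mem_image, Finset.mem_univ, true_and, forall_exists_index,
      forall_apply_eq_imp_iff, norm_smul, Real.norm_eq_abs, abs_unit_intCast, one_mul,
      abs_of_nonneg hg]
    exact fun q => mul_le_of_le_one_right hg (he q.1)
  have hcard : (T.card : ℝ) ≤ N := by
    refine le_trans ?_ hκ
    exact_mod_cast Finset.card_image_le.trans_eq (by simp [mul_comm])
  obtain ⟨C, hC, hcover⟩ := exists_cover_convexHull T hg hT hx hN hcard
  refine ⟨C, hC, fun w hw => hcover _ ?_⟩
  have hw' : ∑ i, |w i / g| ≤ 1 := by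
    simp_rw [abs_div, abs_of_nonneg hg, ← Finset.sum_div]
    exact div_le_one_of_le₀ hw hg
  have hwg (i : κ) : w i / g * g = w i := div_mul_cancel_of_imp fun h => abs_eq_zero.1 <|
    ((Finset.single_le_sum (fun j _ => abs_nonneg (w j)) (Finset.mem_univ i)).trans
      (hw.trans_eq h)).antisymm (abs_nonneg _)
  simpa [hTdef, smul_smul, hwg] using sum_smul_mem_convexHull (fun i => g • e i) hw'

end Maurey

/-! ### Covering the outputs of one layer -/

section LayerCover

/-- A tuple of `n` points of `ℝ^q`, with the norm `dataNorm`. -/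
abbrev DataSpace (n q : ℕ) : Type := PiLp 2 fun _ : Fin n => EuclideanSpace ℝ (Fin q)

/-- The matrix `A` applied to each data point. -/
def mulData {n p q : ℕ} (A : Matrix (Fin p) (Fin q) ℝ) (Z : DataSpace n q) : DataSpace n p :=
  WithLp.toLp 2 fun i => WithLp.toLp 2 (A.mulVec (Z i))

/-- The Euclidean norm of the vector formed by the `c`-th coordinates of the data points. -/
def coordNorm {n q : ℕ} (Z : DataSpace n q) (c : Fin q) : ℝ := √(∑ i, Z i c ^ 2)

/-- The dictionary element for the matrix entry `rc`: the `c`-th coordinates of the data,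
normalised and placed in the coordinate `r`; it vanishes if these coordinates do. -/
def columnAtom {n q : ℕ} (p : ℕ) (Z : DataSpace n q) (rc : Fin p × Fin q) : DataSpace n p :=
  WithLp.toLp 2 fun i =>
    WithLp.toLp 2 fun r => if r = rc.1 then Z i rc.2 / coordNorm Z rc.2 else 0

/-- The matrices of spectral norm at most `s` and of distance at most `a` from `M` in the `(2,1)`
norm of the transpose. -/
def matrixClass {p q : ℕ} (M : Matrix (Fin p) (Fin q) ℝ) (a s : ℝ) :
    Set (Matrix (Fin p) (Fin q) ℝ) :=
  {A | spectralNorm A ≤ s ∧ norm21 (A.transpose - M.transpose) ≤ a}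

/-- The finite set `C` consists of vectors of norm at most `b`, approximates every point of `Y` up
to `ε`, and has logarithmic cardinality at most `ℓ`. -/
structure BoundedCover {E : Type*} [NormedAddCommGroup E] (C : Finset E) (ℓ b ε : ℝ)
    (Y : Set E) : Prop where
  log_card_le : Real.log C.card ≤ ℓ
  norm_le : ∀ c ∈ C, ‖c‖ ≤ b
  exists_norm_sub_le : ∀ y ∈ Y, ∃ c ∈ C, ‖y - c‖ ≤ ε

variable {n p q : ℕ}

lemma mulData_apply (A : Matrix (Fin p) (Fin q) ℝ) (Z : DataSpace n q) (i : Fin n)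
    (r : Fin p) : mulData A Z i r = ∑ c, A r c * Z i c := rfl

lemma mulData_sub_matrix (A B : Matrix (Fin p) (Fin q) ℝ) (Z : DataSpace n q) :
    mulData (A - B) Z = mulData A Z - mulData B Z := by
  ext i r
  simp [mulData_apply, sub_mul, Finset.sum_sub_distrib]

lemma mulData_sub (A : Matrix (Fin p) (Fin q) ℝ) (Y Z : DataSpace n q) :
    mulData A (Y - Z) = mulData A Y - mulData A Z := by
  ext i r
  simp [mulData_apply, mul_sub, Finset.sum_sub_distrib]

lemma norm_dataSpace_sq (Z : DataSpace n q) : ‖Z‖ ^ 2 = ∑ c, ∑ i, Z i c ^ 2 := by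
  simp_rw [PiLp.norm_sq_eq_of_L2, Real.norm_eq_abs, sq_abs]
  exact Finset.sum_comm

lemma norm_dataSpace_le_of_forall {Y : DataSpace n p} {Z : DataSpace n q} {s : ℝ}
    (hs : 0 ≤ s) (h : ∀ i, ‖Y i‖ ≤ s * ‖Z i‖) : ‖Y‖ ≤ s * ‖Z‖ := by
  refine le_of_sq_le_sq ?_ (by positivity)
  rw [mul_pow, PiLp.norm_sq_eq_of_L2, PiLp.norm_sq_eq_of_L2, Finset.mul_sum]
  refine Finset.sum_le_sum fun i _ => ?_
  rw [← mul_pow]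
  exact pow_le_pow_left₀ (norm_nonneg _) (h i) 2

lemma spectralNorm_nonneg (A : Matrix (Fin p) (Fin q) ℝ) : 0 ≤ spectralNorm A := by
  open scoped Matrix.Norms.L2Operator in
  exact norm_nonneg A

lemma norm_mulVec_le (A : Matrix (Fin p) (Fin q) ℝ) (z : EuclideanSpace ℝ (Fin q)) :
    ‖(WithLp.toLp 2 (A.mulVec z) : EuclideanSpace ℝ (Fin p))‖ ≤ spectralNorm A * ‖z‖ :=
  Matrix.l2_opNorm_mulVec A z

lemma norm_mulData_le (A : Matrix (Fin p) (Fin q) ℝ) (Z : DataSpace n q) :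
    ‖mulData A Z‖ ≤ spectralNorm A * ‖Z‖ :=
  norm_dataSpace_le_of_forall (spectralNorm_nonneg A) fun i => norm_mulVec_le A (Z i)

lemma coordNorm_nonneg (Z : DataSpace n q) (c : Fin q) : 0 ≤ coordNorm Z c :=
  Real.sqrt_nonneg _

lemma coordNorm_sq (Z : DataSpace n q) (c : Fin q) : coordNorm Z c ^ 2 = ∑ i, Z i c ^ 2 :=
  Real.sq_sqrt (Finset.sum_nonneg fun _ _ => sq_nonneg _)

lemma norm_eq_sqrt_sum_coordNorm_sq (Z : DataSpace n q) : ‖Z‖ = √(∑ c, coordNorm Z c ^ 2) := by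
  simp_rw [coordNorm_sq]
  rw [← norm_dataSpace_sq, Real.sqrt_sq (norm_nonneg _)]

lemma coordNorm_mul_div_coordNorm (Z : DataSpace n q) (c : Fin q) (i : Fin n) :
    coordNorm Z c * (Z i c / coordNorm Z c) = Z i c := by
  refine mul_div_cancel_of_imp' fun h => sq_eq_zero_iff.1 ?_
  have hsum : ∑ i, Z i c ^ 2 = 0 := by rw [← coordNorm_sq, h, zero_pow two_ne_zero]
  exact (Finset.sum_eq_zero_iff_of_nonneg fun _ _ => sq_nonneg _).1 hsum i (Finset.mem_univ i)

lemma norm_columnAtom_le (Z : DataSpace n q) (rc : Fin p × Fin q) :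
    ‖columnAtom p Z rc‖ ≤ 1 := by
  rw [← sq_le_one_iff₀ (norm_nonneg _), norm_dataSpace_sq,
    Finset.sum_eq_single rc.1 (fun r _ hr => by simp [columnAtom, hr]) (by simp)]
  simp only [columnAtom, if_true, div_pow, ← Finset.sum_div, coordNorm_sq]
  exact div_self_le_one _

lemma mulData_eq_sum (B : Matrix (Fin p) (Fin q) ℝ) (Z : DataSpace n q) :
    mulData B Z =
      ∑ rc : Fin p × Fin q, (B rc.1 rc.2 * coordNorm Z rc.2) • columnAtom p Z rc := by
  ext i r
  rw [mulData_apply, Fintype.sum_prod_type]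
  simp only [columnAtom, WithLp.ofLp_sum, WithLp.ofLp_smul, Finset.sum_apply, Pi.smul_apply,
    smul_eq_mul]
  rw [Finset.sum_eq_single r (fun r' _ hr => by simp [hr.symm]) (by simp)]
  simp only [if_true, mul_assoc, coordNorm_mul_div_coordNorm]

/-- Cauchy–Schwarz in each row of `B`: the `(2,1)` norm of the transpose is what bounds the
coefficients of `mulData_eq_sum`. -/
lemma sum_abs_mul_coordNorm_le (B : Matrix (Fin p) (Fin q) ℝ) (Z : DataSpace n q) :
    ∑ rc : Fin p × Fin q, |B rc.1 rc.2 * coordNorm Z rc.2| ≤ norm21 B.transpose * ‖Z‖ := by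
  rw [Fintype.sum_prod_type, norm21, Finset.sum_mul, norm_eq_sqrt_sum_coordNorm_sq]
  refine Finset.sum_le_sum fun r _ => ?_
  simpa only [abs_mul, abs_of_nonneg (coordNorm_nonneg Z _), sq_abs, Matrix.transpose_apply]
    using Real.sum_mul_le_sqrt_mul_sqrt Finset.univ (fun c => |B r c|) fun c => coordNorm Z c

lemma exists_mulData_cover {W : ℕ} (hW : 1 ≤ W) (hp : p ≤ W) (hq : q ≤ W) (Z : DataSpace n q)
    {a x : ℝ} (ha : 0 ≤ a) (hx : 0 < x) :
    ∃ C : Finset (DataSpace n p), Real.log C.card ≤ 2 * x * Real.log (2 * W ^ 2) ∧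
      ∀ B : Matrix (Fin p) (Fin q) ℝ, norm21 B.transpose ≤ a →
        ∃ c ∈ C, ‖mulData B Z - c‖ ≤ a * ‖Z‖ / √x := by
  have hN : (1 : ℝ) ≤ 2 * W ^ 2 := by
    exact_mod_cast (Nat.one_le_pow 2 W hW).trans (Nat.le_mul_of_pos_left _ two_pos)
  have hκ : 2 * (Fintype.card (Fin p × Fin q) : ℝ) ≤ 2 * W ^ 2 := by
    rw [Fintype.card_prod, Fintype.card_fin, Fintype.card_fin, sq]
    exact_mod_cast Nat.mul_le_mul_left 2 (Nat.mul_le_mul hp hq)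
  obtain ⟨C, hC, hcover⟩ := exists_cover_absConvex (norm_columnAtom_le (p := p) Z)
    (mul_nonneg ha (norm_nonneg Z)) hx hN hκ
  refine ⟨C, hC, fun B hB => ?_⟩
  rw [mulData_eq_sum]
  exact hcover _ ((sum_abs_mul_coordNorm_le B Z).trans (by gcongr))

lemma exists_layer_cover {W : ℕ} (hW : 1 ≤ W) (hp : p ≤ W) (hq : q ≤ W)
    (M : Matrix (Fin p) (Fin q) ℝ) (Z : DataSpace n q) {a s x : ℝ} (ha : 0 ≤ a) (hs : 0 ≤ s)
    (hx : 0 < x) :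
    ∃ C : Finset (DataSpace n p), BoundedCover C (2 * x * Real.log (2 * W ^ 2)) (s * ‖Z‖)
      (a * ‖Z‖ / √x) ((fun A => mulData A Z) '' matrixClass M a s) := by
  classical
  obtain ⟨C, hC, hcover⟩ := exists_mulData_cover hW hp hq Z ha hx
  obtain ⟨C', hC', hball, hproj⟩ := exists_finset_projection
    (K := Metric.closedBall (0 : DataSpace n p) (s * ‖Z‖))
    (Metric.nonempty_closedBall.2 (by positivity)) Metric.isClosed_closedBall.isComplete
    (convex_closedBall _ _) (C.map (addLeftEmbedding (mulData M Z)))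
  rw [Finset.card_map] at hC'
  refine ⟨C', hC'.trans hC, by simpa using hball, ?_⟩
  rintro _ ⟨A, ⟨hA, hAM⟩, rfl⟩
  obtain ⟨c, hc, hdist⟩ := hcover (A - M) (by rwa [Matrix.transpose_sub])
  obtain ⟨v, hv, hle⟩ := hproj _ (Finset.mem_map_of_mem _ hc)
  refine ⟨v, hv, (hle _ ?_).trans ?_⟩
  · simpa using (norm_mulData_le A Z).trans (by gcongr)
  · rw [mulData_sub_matrix] at hdist
    rwa [addLeftEmbedding_apply, ← sub_sub]

end LayerCover

/-! ### Covering the outputs of the network -/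

section NetworkCover

/-- A map applied to each data point. -/
def mapData {n p q : ℕ} (f : EuclideanSpace ℝ (Fin p) → EuclideanSpace ℝ (Fin q))
    (Z : DataSpace n p) : DataSpace n q :=
  WithLp.toLp 2 fun k => f (Z k)

section Step

variable {n p q r : ℕ} {f : EuclideanSpace ℝ (Fin p) → EuclideanSpace ℝ (Fin r)} {K : NNReal}

lemma norm_mapData_sub_le (hf : LipschitzWith K f) (Y Z : DataSpace n p) :
    ‖mapData f Y - mapData f Z‖ ≤ K * ‖Y - Z‖ :=
  norm_dataSpace_le_of_forall K.2 fun k => hf.norm_sub_le (Y k) (Z k)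

lemma norm_mapData_le (hf : LipschitzWith K f) (hf0 : f 0 = 0) (Z : DataSpace n p) :
    ‖mapData f Z‖ ≤ K * ‖Z‖ :=
  norm_dataSpace_le_of_forall K.2 fun k => by
    have h := hf.norm_sub_le (Z k) 0
    rwa [hf0, sub_zero, sub_zero] at h

lemma log_card_biUnion_le {α β : Type*} [DecidableEq β] {C : Finset α} {D : α → Finset β}
    {ℓ ℓ' : ℝ} (hℓ' : 0 ≤ ℓ') (hC : Real.log C.card ≤ ℓ)
    (hD : ∀ c ∈ C, Real.log (D c).card ≤ ℓ') :
    Real.log (C.biUnion D).card ≤ ℓ + ℓ' := by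
  have card_le {N : ℕ} {t : ℝ} (h : Real.log N ≤ t) : (N : ℝ) ≤ Real.exp t :=
    (Real.le_exp_log _).trans (Real.exp_le_exp.2 h)
  rcases (C.biUnion D).card.eq_zero_or_pos with h | h
  · rw [h, Nat.cast_zero, Real.log_zero]
    exact add_nonneg ((Real.log_natCast_nonneg _).trans hC) hℓ'
  · rw [Real.log_le_iff_le_exp (Nat.cast_pos.2 h), Real.exp_add]
    calc ((C.biUnion D).card : ℝ) ≤ ∑ c ∈ C, ((D c).card : ℝ) := by
          exact_mod_cast Finset.card_biUnion_le
      _ ≤ ∑ _c ∈ C, Real.exp ℓ' := Finset.sum_le_sum fun c hc => card_le (hD c hc)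
      _ = C.card * Real.exp ℓ' := by rw [Finset.sum_const, nsmul_eq_mul]
      _ ≤ Real.exp ℓ * Real.exp ℓ' := by gcongr; exact card_le hC

lemma BoundedCover.exists_layer {W : ℕ} (hW : 1 ≤ W) (hp : p ≤ W) (hq : q ≤ W)
    (hf : LipschitzWith K f) (hf0 : f 0 = 0) (M : Matrix (Fin p) (Fin q) ℝ) {a s x : ℝ}
    (ha : 0 ≤ a) (hs : 0 ≤ s) (hx : 0 < x) {C : Finset (DataSpace n q)} {ℓ b ε : ℝ}
    {𝒵 : Set (DataSpace n q)} (hC : BoundedCover C ℓ b ε 𝒵) :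
    ∃ C' : Finset (DataSpace n r), BoundedCover C' (ℓ + 2 * x * Real.log (2 * W ^ 2))
      (K * (s * b)) (K * (s * ε + a * b / √x))
      (Set.image2 (fun A Z => mapData f (mulData A Z)) (matrixClass M a s) 𝒵) := by
  classical
  choose D hD using fun Z : DataSpace n q => exists_layer_cover hW hp hq M Z ha hs hx
  have hlog : 0 ≤ Real.log (2 * W ^ 2) := by
    exact_mod_cast Real.log_natCast_nonneg (2 * W ^ 2)
  refine ⟨C.biUnion fun c => (D c).image (mapData f),
    log_card_biUnion_le (by positivity) hC.log_card_le fun c _ =>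
      (log_card_image_le_log_card _ _).trans (hD c).log_card_le, ?_, ?_⟩
  · simp only [Finset.mem_biUnion, Finset.mem_image, forall_exists_index, and_imp]
    rintro _ c hc y hy rfl
    refine (norm_mapData_le hf hf0 y).trans ?_
    gcongr
    exact ((hD c).norm_le y hy).trans (by gcongr; exact hC.norm_le c hc)
  · rintro _ ⟨A, hA, Z, hZ, rfl⟩
    obtain ⟨c, hc, hcZ⟩ := hC.exists_norm_sub_le Z hZ
    obtain ⟨y, hy, hyc⟩ := (hD c).exists_norm_sub_le _ (Set.mem_image_of_mem _ hA)
    refine ⟨mapData f y, Finset.mem_biUnion.2 ⟨c, hc, Finset.mem_image_of_mem _ hy⟩,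
      (norm_mapData_sub_le hf _ _).trans ?_⟩
    gcongr
    calc ‖mulData A Z - y‖ ≤ ‖mulData A (Z - c)‖ + ‖mulData A c - y‖ := by
          rw [mulData_sub]
          exact norm_sub_le_norm_sub_add_norm_sub _ _ _
      _ ≤ s * ε + a * b / √x := by
          gcongr
          · exact (norm_mulData_le A _).trans (mul_le_mul hA.1 hcZ (norm_nonneg _) hs)
          · exact hyc.trans (by gcongr; exact hC.norm_le c hc)

end Step

section Accuracies

variable {ι : Type*} [Fintype ι] [DecidableEq ι]

/-- The sum `∑ᵢ (aᵢ ∏_{j ≠ i} sⱼ)^{2/3}` that governs the metric entropy of the networks. -/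
def complexitySum (a s : ι → ℝ) : ℝ :=
  ∑ i, (a i * ∏ j ∈ Finset.univ.erase i, s j) ^ (2 / 3 : ℝ)

lemma complexitySum_nonneg {a s : ι → ℝ} (ha : ∀ i, 0 ≤ a i) (hs : ∀ i, 0 ≤ s i) :
    0 ≤ complexitySum a s :=
  Finset.sum_nonneg fun i _ => Real.rpow_nonneg
    (mul_nonneg (ha i) (Finset.prod_nonneg fun j _ => hs j)) _

lemma complexitySum_mono {a s a' s' : ι → ℝ} (ha : ∀ i, 0 ≤ a i) (hs : ∀ i, 0 ≤ s i)
    (haa : ∀ i, a i ≤ a' i) (hss : ∀ i, s i ≤ s' i) :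
    complexitySum a s ≤ complexitySum a' s' := by
  have hprod (i : ι) : 0 ≤ ∏ j ∈ Finset.univ.erase i, s j :=
    Finset.prod_nonneg fun j _ => hs j
  refine Finset.sum_le_sum fun i _ =>
    Real.rpow_le_rpow (mul_nonneg (ha i) (hprod i)) ?_ (by norm_num)
  exact mul_le_mul (haa i) (Finset.prod_le_prod (fun j _ => hs j) fun j _ => hss j) (hprod i)
    ((ha i).trans (haa i))

lemma complexitySum_pos [Nonempty ι] {a s : ι → ℝ} (ha : ∀ i, 0 < a i) (hs : ∀ i, 0 < s i) :
    0 < complexitySum a s :=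
  Finset.sum_pos (fun i _ => Real.rpow_pos_of_pos
    (mul_pos (ha i) (Finset.prod_pos fun j _ => hs j)) _) Finset.univ_nonempty

/-- With `u i = a i * ∏ j ≠ i, s j`, taking `√(x i)` proportional to `u i ^ (1 / 3)` minimises
`∑ i, x i` for a given value of `∑ i, u i / √(x i)`. -/
lemma exists_accuracies [Nonempty ι] {a s : ι → ℝ} (ha : ∀ i, 0 < a i) (hs : ∀ i, 0 < s i)
    {T ε : ℝ} (hT : 0 < T) (hε : 0 < ε) :
    ∃ x : ι → ℝ, (∀ i, 0 < x i) ∧ ∑ i, x i = T ^ 2 * complexitySum a s ^ 3 / ε ^ 2 ∧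
      T * (∏ i, s i) * ∑ i, a i / (s i * √(x i)) = ε := by
  set U := complexitySum a s
  have hUpos : 0 < U := complexitySum_pos ha hs
  let u (i : ι) : ℝ := a i * ∏ j ∈ Finset.univ.erase i, s j
  have hu (i : ι) : 0 < u i := mul_pos (ha i) (Finset.prod_pos fun j _ => hs j)
  have hu3 (i : ι) : 0 < u i ^ (1 / 3 : ℝ) := Real.rpow_pos_of_pos (hu i) _
  set c := T * U / ε with hc
  have hcpos : 0 < c := by positivity
  refine ⟨fun i => (c * u i ^ (1 / 3 : ℝ)) ^ 2, fun i => by have := hu3 i; positivity, ?_, ?_⟩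
  · have hsq (i : ι) : (c * u i ^ (1 / 3 : ℝ)) ^ 2 = c ^ 2 * u i ^ (2 / 3 : ℝ) := by
      rw [mul_pow, ← Real.rpow_natCast (u i ^ (1 / 3 : ℝ)), ← Real.rpow_mul (hu i).le]
      norm_num
    simp_rw [hsq, ← Finset.mul_sum, hc]
    change (T * U / ε) ^ 2 * U = _
    ring
  · have hterm (i : ι) : a i / (s i * √((c * u i ^ (1 / 3 : ℝ)) ^ 2)) =
        1 / ((∏ j, s j) * c) * u i ^ (2 / 3 : ℝ) := by
      have hsplit : u i ^ (2 / 3 : ℝ) * u i ^ (1 / 3 : ℝ) =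
          a i * ∏ j ∈ Finset.univ.erase i, s j := by
        rw [← Real.rpow_add (hu i)]
        norm_num [u]
      have hserase : 0 < ∏ j ∈ Finset.univ.erase i, s j := Finset.prod_pos fun j _ => hs j
      have hsi := hs i
      have hui := hu3 i
      rw [Real.sqrt_sq (by positivity), ← Finset.mul_prod_erase Finset.univ s (Finset.mem_univ i)]
      field_simp
      linarith
    have hprod : 0 < ∏ j, s j := Finset.prod_pos fun j _ => hs j
    simp_rw [hterm, ← Finset.mul_sum]
    change T * (∏ j, s j) * (1 / ((∏ j, s j) * c) * U) = ε
    rw [hc]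
    field_simp

end Accuracies

variable {L n : ℕ} {d : Fin (L + 1) → ℕ} {m : Fin L → ℕ}

/-- The output of the first `i` layers on all data points. -/
def layerData (σ : Nonlinearities d m) (A : Weights d m)
    (X : Fin n → EuclideanSpace ℝ (Fin (d 0))) (i : Fin (L + 1)) : DataSpace n (d i) :=
  WithLp.toLp 2 fun k => layerOutput σ A (X k) i

/-- The weights whose `i`-th matrix lies in `matrixClass (M i) (a i) (s i)`. -/
def weightClass (M : Weights d m) (a s : Fin L → ℝ) : Set (Weights d m) :=
  {A | ∀ i, A i ∈ matrixClass (M i) (a i) (s i)}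

/-- The layers that have been applied in the `i`-th intermediate output. -/
def layersBelow (i : Fin (L + 1)) : Finset (Fin L) :=
  Finset.univ.filter fun j => j.castSucc < i

lemma layerOutput_succ (σ : Nonlinearities d m) (A : Weights d m)
    (x : EuclideanSpace ℝ (Fin (d 0))) (i : Fin L) :
    layerOutput σ A x i.succ =
      σ i (WithLp.toLp 2 (Matrix.mulVec (A i) (layerOutput σ A x i.castSucc))) := by
  rw [layerOutput, Fin.induction_succ]
  rfl

lemma layerData_succ (σ : Nonlinearities d m) (A : Weights d m)
    (X : Fin n → EuclideanSpace ℝ (Fin (d 0))) (i : Fin L) :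
    layerData σ A X i.succ = mapData (σ i) (mulData (A i) (layerData σ A X i.castSucc)) :=
  PiLp.ext fun k => layerOutput_succ σ A (X k) i

lemma norm_layerData_zero (σ : Nonlinearities d m) (A : Weights d m)
    (X : Fin n → EuclideanSpace ℝ (Fin (d 0))) : ‖layerData σ A X 0‖ = dataNorm X :=
  PiLp.norm_eq_of_L2 _

lemma layersBelow_zero : layersBelow (0 : Fin (L + 1)) = ∅ := by
  simp [layersBelow]

lemma layersBelow_last : layersBelow (Fin.last L) = Finset.univ := by
  simp [layersBelow, Fin.castSucc_lt_last]

lemma notMem_layersBelow (i : Fin L) : i ∉ layersBelow i.castSucc := by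
  simp [layersBelow]

lemma layersBelow_succ (i : Fin L) :
    layersBelow i.succ = insert i (layersBelow i.castSucc) := by
  ext j
  simp [layersBelow, Fin.castSucc_lt_succ_iff, le_iff_eq_or_lt]

lemma le_width_left (i : Fin (L + 1)) : d i ≤ width d m :=
  (Finset.le_sup (Finset.mem_univ i)).trans (le_max_left _ _)

lemma le_width_right (i : Fin L) : m i ≤ width d m :=
  (Finset.le_sup (Finset.mem_univ i)).trans (le_max_right _ _)

variable {σ : Nonlinearities d m} {ρ : Fin L → NNReal}

lemma exists_layerData_cover (hW : 1 ≤ width d m) (hσ : ∀ i, LipschitzWith (ρ i) (σ i))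
    (hσ0 : ∀ i, σ i 0 = 0) (M : Weights d m) {a s x : Fin L → ℝ} (ha : ∀ i, 0 ≤ a i)
    (hs : ∀ i, 0 < s i) (hx : ∀ i, 0 < x i) (X : Fin n → EuclideanSpace ℝ (Fin (d 0)))
    (i : Fin (L + 1)) :
    ∃ C : Finset (DataSpace n (d i)), BoundedCover C
      (∑ j ∈ layersBelow i, 2 * x j * Real.log (2 * (width d m : ℝ) ^ 2))
      ((∏ j ∈ layersBelow i, ρ j * s j) * dataNorm X)
      ((∏ j ∈ layersBelow i, ρ j * s j) * dataNorm X *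
        ∑ j ∈ layersBelow i, a j / (s j * √(x j)))
      ((fun A => layerData σ A X i) '' weightClass M a s) := by
  induction i using Fin.induction with
  | zero =>
    refine ⟨{layerData σ M X 0}, by simp [layersBelow_zero],
      by simp [layersBelow_zero, norm_layerData_zero], ?_⟩
    rintro _ ⟨A, -, rfl⟩
    refine ⟨_, Finset.mem_singleton_self _, ?_⟩
    simp [layersBelow_zero, show layerData σ A X 0 = layerData σ M X 0 from rfl]
  | succ i ih =>
    obtain ⟨C, hC⟩ := ih
    obtain ⟨C', hlog, hnorm, hcover⟩ := hC.exists_layer hW (le_width_right (d := d) i)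
      (le_width_left i.castSucc) (hσ i) (hσ0 i) (M i) (ha i) (hs i).le (hx i)
    have hsi := (hs i).ne'
    have hxi := (Real.sqrt_pos.2 (hx i)).ne'
    rw [layersBelow_succ, Finset.sum_insert (notMem_layersBelow i),
      Finset.prod_insert (notMem_layersBelow i), Finset.sum_insert (notMem_layersBelow i)]
    refine ⟨C', hlog.trans_eq (add_comm _ _), fun c hc => (hnorm c hc).trans_eq (by ring), ?_⟩
    rintro _ ⟨A, hA, rfl⟩
    obtain ⟨c, hc, hle⟩ := hcover _
      (Set.mem_image2_of_mem (hA i) (Set.mem_image_of_mem (layerData σ · X i.castSucc) hA))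
    refine ⟨c, hc, ?_⟩
    simp only [layerData_succ]
    refine hle.trans_eq ?_
    field_simp
    ring

lemma exists_network_cover (hL : 1 ≤ L) (hW : 1 ≤ width d m)
    (hσ : ∀ i, LipschitzWith (ρ i) (σ i)) (hσ0 : ∀ i, σ i 0 = 0) (M : Weights d m)
    {a s : Fin L → ℝ} (ha : ∀ i, 0 < a i) (hs : ∀ i, 0 < s i)
    (X : Fin n → EuclideanSpace ℝ (Fin (d 0))) {T : ℝ} (hT : 0 < T)
    (hTX : (∏ i, (ρ i : ℝ)) * dataNorm X ≤ T) {ε : ℝ} (hε : 0 < ε) :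
    ∃ C : Finset (DataSpace n (d (Fin.last L))),
      Real.log C.card ≤
        2 * Real.log (2 * (width d m : ℝ) ^ 2) * T ^ 2 * complexitySum a s ^ 3 / ε ^ 2 ∧
      ∀ A ∈ weightClass M a s, ∃ c ∈ C, ‖layerData σ A X (Fin.last L) - c‖ ≤ ε := by
  have : Nonempty (Fin L) := ⟨⟨0, hL⟩⟩
  obtain ⟨x, hx, hsum, haccuracy⟩ := exists_accuracies ha hs hT hε
  obtain ⟨C, hlog, -, hcover⟩ :=
    exists_layerData_cover hW hσ hσ0 M (fun i => (ha i).le) hs hx X (Fin.last L)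
  rw [layersBelow_last] at hlog hcover
  refine ⟨C, hlog.trans_eq ?_, fun A hA => ?_⟩
  · rw [← Finset.sum_mul, ← Finset.mul_sum, hsum]
    ring
  · obtain ⟨c, hc, hle⟩ := hcover _ (Set.mem_image_of_mem _ hA)
    have hsum0 : 0 ≤ ∑ i, a i / (s i * √(x i)) := Finset.sum_nonneg fun i _ =>
      div_nonneg (ha i).le (mul_nonneg (hs i).le (Real.sqrt_nonneg _))
    have hprod : 0 ≤ ∏ i, s i := Finset.prod_nonneg fun i _ => (hs i).le
    refine ⟨c, hc, hle.trans (haccuracy ▸ ?_)⟩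
    rw [Finset.prod_mul_distrib, mul_right_comm (∏ i, (ρ i : ℝ))]
    gcongr

end NetworkCover

/-! ### Chaining -/

section Massart

variable {ι κ : Type*} [Fintype κ] [DecidableEq κ]

lemma expect_exp_sum_le (u : κ → ℝ) :
    𝔼 ε : κ → ℤˣ, Real.exp (∑ k, (ε k : ℤ) * u k) ≤ Real.exp ((∑ k, u k ^ 2) / 2) := by
  have hsign (x : ℝ) : ∑ e : ℤˣ, Real.exp ((e : ℤ) * x) = 2 * Real.cosh x := by
    simp only [UnitsInt.univ, Finset.mem_singleton, units_ne_neg_self, not_false_eq_true,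
      Finset.sum_insert, Finset.sum_singleton, Units.val_one, Units.val_neg, Int.cast_one,
      Int.cast_neg, one_mul, neg_mul, Real.cosh_eq]
    ring
  calc 𝔼 ε : κ → ℤˣ, Real.exp (∑ k, (ε k : ℤ) * u k)
      = (∏ k, ∑ e : ℤˣ, Real.exp ((e : ℤ) * u k)) / 2 ^ Fintype.card κ := by
        rw [Finset.prod_univ_sum, Fintype.piFinset_univ, Fintype.expect_eq_sum_div_card]
        simp [Real.exp_sum]
    _ = ∏ k, Real.cosh (u k) := by
        simp_rw [hsign, Finset.prod_mul_distrib, Finset.prod_const, Finset.card_univ]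
        exact mul_div_cancel_left₀ _ (by positivity)
    _ ≤ ∏ k, Real.exp (u k ^ 2 / 2) :=
        Finset.prod_le_prod (fun _ _ => (Real.cosh_pos _).le) fun _ _ =>
          Real.cosh_le_exp_half_sq _
    _ = Real.exp ((∑ k, u k ^ 2) / 2) := by rw [← Real.exp_sum, Finset.sum_div]

lemma rademacherAvg_add_le [Finite ι] [Nonempty ι] (v w : ι → κ → ℝ) :
    rademacherAvg (fun i k => v i k + w i k) ≤ rademacherAvg v + rademacherAvg w := by
  have hbdd (a : ι → ℝ) : BddAbove (Set.range a) := (Set.finite_range a).bddAbove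
  rw [rademacherAvg, rademacherAvg, rademacherAvg, ← Finset.expect_add_distrib]
  refine Finset.expect_le_expect fun ε _ => ciSup_le fun i => ?_
  simp_rw [mul_add, Finset.sum_add_distrib]
  exact add_le_add (le_ciSup (f := fun i => ∑ k, (ε k : ℤ) * v i k) (hbdd _) i)
    (le_ciSup (f := fun i => ∑ k, (ε k : ℤ) * w i k) (hbdd _) i)

lemma rademacherAvg_le_sqrt_mul [Nonempty ι] {v : ι → EuclideanSpace ℝ κ} {r : ℝ}
    (h : ∀ i, ‖v i‖ ≤ r) : rademacherAvg (fun i k => v i k) ≤ √(Fintype.card κ) * r := by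
  refine Finset.expect_le Finset.univ_nonempty fun ε _ => ciSup_le fun i => ?_
  have hε (k : κ) : (((ε k : ℤ) : ℝ)) ^ 2 = 1 := by
    rw [← sq_abs, abs_unit_intCast, one_pow]
  calc ∑ k, (ε k : ℤ) * v i k ≤ √(∑ k, ((ε k : ℤ) : ℝ) ^ 2) * √(∑ k, v i k ^ 2) :=
        Real.sum_mul_le_sqrt_mul_sqrt _ _ _
    _ = √(Fintype.card κ) * ‖v i‖ := by
        simp [hε, EuclideanSpace.norm_eq]
    _ ≤ √(Fintype.card κ) * r := by gcongr; exact h i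

lemma exp_mul_rademacherAvg_le [Finite ι] [Nonempty ι] {v : ι → EuclideanSpace ℝ κ}
    {C : Finset (EuclideanSpace ℝ κ)} (hv : ∀ i, v i ∈ C) {r : ℝ} (hr : ∀ u ∈ C, ‖u‖ ≤ r)
    {t : ℝ} :
    Real.exp (t * rademacherAvg fun i k => v i k) ≤ C.card * Real.exp (t ^ 2 * r ^ 2 / 2) := by
  have hjensen : Real.exp (t * rademacherAvg fun i k => v i k) ≤
      𝔼 ε : κ → ℤˣ, Real.exp (t * ⨆ i, ∑ k, (ε k : ℤ) * v i k) := by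
    have h := convexOn_exp.map_sum_le (t := (Finset.univ : Finset (κ → ℤˣ)))
      (w := fun _ => (Fintype.card (κ → ℤˣ) : ℝ)⁻¹)
      (p := fun ε => t * ⨆ i, ∑ k, (ε k : ℤ) * v i k) (fun _ _ => by positivity)
      (by simp) fun _ _ => Set.mem_univ _
    simp only [smul_eq_mul, ← Finset.mul_sum] at h
    rwa [rademacherAvg, Finset.mul_expect, Fintype.expect_eq_sum_div_card,
      Fintype.expect_eq_sum_div_card, div_eq_inv_mul, div_eq_inv_mul, ← Finset.mul_sum]
  have hmax (ε : κ → ℤˣ) : Real.exp (t * ⨆ i, ∑ k, (ε k : ℤ) * v i k) ≤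
      ∑ u ∈ C, Real.exp (∑ k, (ε k : ℤ) * (t * u k)) := by
    obtain ⟨i, hi⟩ := exists_eq_ciSup_of_finite (f := fun i => ∑ k, (ε k : ℤ) * v i k)
    rw [← hi, Finset.mul_sum]
    simp_rw [mul_left_comm t]
    exact Finset.single_le_sum (f := fun u => Real.exp (∑ k, (ε k : ℤ) * (t * u k)))
      (fun u _ => (Real.exp_pos _).le) (hv i)
  calc Real.exp (t * rademacherAvg fun i k => v i k)
      ≤ 𝔼 ε : κ → ℤˣ, ∑ u ∈ C, Real.exp (∑ k, (ε k : ℤ) * (t * u k)) :=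
        hjensen.trans (Finset.expect_le_expect fun ε _ => hmax ε)
    _ = ∑ u ∈ C, 𝔼 ε : κ → ℤˣ, Real.exp (∑ k, (ε k : ℤ) * (t * u k)) :=
        Finset.expect_sum_comm _ _ _
    _ ≤ ∑ u ∈ C, Real.exp (t ^ 2 * r ^ 2 / 2) := by
        refine Finset.sum_le_sum fun u hu => (expect_exp_sum_le _).trans ?_
        have hnorm : ∑ k, (t * u k) ^ 2 = t ^ 2 * ‖u‖ ^ 2 := by
          simp_rw [EuclideanSpace.real_norm_sq_eq, mul_pow, Finset.mul_sum]
        rw [hnorm]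
        gcongr
        exact hr u hu
    _ = C.card * Real.exp (t ^ 2 * r ^ 2 / 2) := by rw [Finset.sum_const, nsmul_eq_mul]

lemma le_mul_sqrt_of_forall_mul_le {x r ℓ : ℝ} (hr : 0 ≤ r)
    (h : ∀ t, t * x ≤ ℓ + t ^ 2 * r ^ 2 / 2) : x ≤ r * √(2 * ℓ) := by
  have hdiscrim := discrim_le_zero (a := r ^ 2 / 2) (b := -x) (c := ℓ) fun t => by
    linarith [h t]
  rw [discrim] at hdiscrim
  refine (Real.le_sqrt_of_sq_le (y := r ^ 2 * (2 * ℓ)) (by linarith)).trans_eq ?_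
  rw [Real.sqrt_mul (sq_nonneg r), Real.sqrt_sq hr]

/-- **Massart's lemma**. -/
lemma rademacherAvg_le_of_forall_mem [Finite ι] [Nonempty ι] {v : ι → EuclideanSpace ℝ κ}
    {C : Finset (EuclideanSpace ℝ κ)} (hv : ∀ i, v i ∈ C) {r ℓ : ℝ} (hr : ∀ i, ‖v i‖ ≤ r)
    (hC : Real.log C.card ≤ ℓ) :
    rademacherAvg (fun i k => v i k) ≤ r * √(2 * ℓ) := by
  obtain ⟨i⟩ := ‹Nonempty ι›
  have : Nonempty ι := ⟨i⟩
  set D := C.filter (‖·‖ ≤ r)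
  have hvD (i : ι) : v i ∈ D := Finset.mem_filter.2 ⟨hv i, hr i⟩
  have hDpos : 0 < D.card := Finset.card_pos.2 ⟨_, hvD i⟩
  have hDlog : Real.log D.card ≤ ℓ := (Real.log_le_log (Nat.cast_pos.2 hDpos)
    (Nat.cast_le.2 (Finset.card_filter_le _ _))).trans hC
  refine le_mul_sqrt_of_forall_mul_le ((norm_nonneg _).trans (hr i)) fun t => ?_
  have hexp := Real.log_le_log (Real.exp_pos _) <|
    exp_mul_rademacherAvg_le (t := t) hvD fun u hu => (Finset.mem_filter.1 hu).2
  rw [Real.log_exp, Real.log_mul (Nat.cast_ne_zero.2 hDpos.ne') (Real.exp_pos _).ne',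
    Real.log_exp] at hexp
  linarith

end Massart

lemma exists_dyadic_approximations {ι κ : Type*} [Fintype κ] {v : ι → EuclideanSpace ℝ κ}
    {R K : ℝ} (hR : 0 < R) (hv : ∀ i, ‖v i‖ ≤ R)
    (hcover : ∀ ε : ℝ, 0 < ε → ∃ C : Finset (EuclideanSpace ℝ κ),
      Real.log C.card ≤ K ^ 2 / ε ^ 2 ∧ ∀ i, ∃ c ∈ C, ‖v i - c‖ ≤ ε) :
    ∃ (C : ℕ → Finset (EuclideanSpace ℝ κ)) (p : ℕ → ι → EuclideanSpace ℝ κ), p 0 = 0 ∧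
      ∀ j, Real.log (C j).card ≤ K ^ 2 / (R / 2 ^ j) ^ 2 ∧ (∀ i, p j i ∈ C j) ∧
        ∀ i, ‖v i - p j i‖ ≤ R / 2 ^ j := by
  choose C hC p hpC hp using fun j : ℕ => hcover (R / 2 ^ (j + 1)) (by positivity)
  refine ⟨fun j => j.casesOn {0} C, fun j => j.casesOn 0 p, rfl, fun j => ?_⟩
  cases j with
  | zero => exact ⟨by simpa using by positivity, by simp, by simpa using hv⟩
  | succ j => exact ⟨hC j, hpC j, hp j⟩

section Dudley

variable {ι κ : Type*} [Finite ι] [Nonempty ι] [Fintype κ] [DecidableEq κ]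
  {v : ι → EuclideanSpace ℝ κ}

lemma rademacherAvg_sub_le_sub_add {p q : ι → EuclideanSpace ℝ κ}
    {C D : Finset (EuclideanSpace ℝ κ)} {ε ℓ : ℝ} (hpC : ∀ i, p i ∈ C) (hqD : ∀ i, q i ∈ D)
    (hC : Real.log C.card ≤ ℓ) (hD : Real.log D.card ≤ ℓ) (hp : ∀ i, ‖v i - p i‖ ≤ 2 * ε)
    (hq : ∀ i, ‖v i - q i‖ ≤ ε) :
    rademacherAvg (fun i k => (v i - p i) k) ≤
      rademacherAvg (fun i k => (v i - q i) k) + 6 * ε * √ℓ := by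
  classical
  have hℓ : 0 ≤ ℓ := (Real.log_natCast_nonneg _).trans hC
  have hcard : Real.log (Finset.image₂ (· - ·) D C).card ≤ ℓ + ℓ := by
    rw [← Finset.biUnion_image_left]
    exact log_card_biUnion_le hℓ hD fun _ _ => (log_card_image_le_log_card _ _).trans hC
  have hmassart := rademacherAvg_le_of_forall_mem (v := fun i => q i - p i) (r := 3 * ε)
    (fun i => Finset.mem_image₂_of_mem (hqD i) (hpC i))
    (fun i => by
      calc ‖q i - p i‖ = ‖(v i - p i) - (v i - q i)‖ := by rw [sub_sub_sub_cancel_left]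
        _ ≤ ‖v i - p i‖ + ‖v i - q i‖ := norm_sub_le _ _
        _ ≤ 3 * ε := by linarith [hp i, hq i]) hcard
  have hsplit : (fun i k => (v i - p i) k) = fun i k => (v i - q i) k + (q i - p i) k := by
    ext i k
    simp
  have hsqrt : √(2 * (ℓ + ℓ)) = 2 * √ℓ := by
    rw [show 2 * (ℓ + ℓ) = 2 ^ 2 * ℓ by ring, Real.sqrt_mul (by positivity),
      Real.sqrt_sq zero_le_two]
  rw [hsqrt] at hmassart
  rw [hsplit]
  exact (rademacherAvg_add_le _ _).trans (by linarith)

/-- **Dudley's chaining bound** for a class whose metric entropy at scale `ε` is at most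
`K ^ 2 / ε ^ 2`: each halving of the scale costs the same. -/
lemma rademacherAvg_le_of_entropy_le {R K : ℝ} (hR : 0 < R) (hK : 0 ≤ K)
    (hv : ∀ i, ‖v i‖ ≤ R)
    (hcover : ∀ ε : ℝ, 0 < ε → ∃ C : Finset (EuclideanSpace ℝ κ),
      Real.log C.card ≤ K ^ 2 / ε ^ 2 ∧ ∀ i, ∃ c ∈ C, ‖v i - c‖ ≤ ε) (J : ℕ) :
    rademacherAvg (fun i k => v i k) ≤ √(Fintype.card κ) * (R / 2 ^ J) + 6 * K * J := by
  obtain ⟨C, p, hp0, h⟩ := exists_dyadic_approximations hR hv hcover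
  have hstep (j : ℕ) : rademacherAvg (fun i k => (v i - p j i) k) ≤
      rademacherAvg (fun i k => (v i - p (j + 1) i) k) + 6 * K := by
    have hscale : R / 2 ^ j = 2 * (R / 2 ^ (j + 1)) := by
      rw [pow_succ]
      field_simp
    have hpos : 0 < R / 2 ^ (j + 1) := by positivity
    have hle := rademacherAvg_sub_le_sub_add (h j).2.1 (h (j + 1)).2.1
      ((h j).1.trans (by rw [hscale]; gcongr; linarith)) (h (j + 1)).1
      (fun i => hscale ▸ (h j).2.2 i) (h (j + 1)).2.2
    rwa [← div_pow, Real.sqrt_sq (by positivity), mul_assoc, mul_div_cancel₀ _ hpos.ne'] at hle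
  have hchain (J : ℕ) : rademacherAvg (fun i k => v i k) ≤
      rademacherAvg (fun i k => (v i - p J i) k) + 6 * K * J := by
    induction J with
    | zero => simp [hp0]
    | succ J ih =>
      push_cast
      linarith [hstep J]
  exact (hchain J).trans (by gcongr; exact rademacherAvg_le_sqrt_mul (h J).2.2)

end Dudley

/-! ### Ramp losses of networks -/

section Ramp

variable {γ γ' : ℝ}

lemma ramp_eq (hγ : 0 < γ) (r : ℝ) : ramp γ r = max 0 (min 1 (1 + r / γ)) := by
  unfold ramp
  split_ifs with h1 h2
  · have : r / γ < -1 := by rwa [div_lt_iff₀ hγ, neg_one_mul]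
    rw [max_eq_left]
    exact (min_le_right _ _).trans (by linarith)
  · have hlower : -1 ≤ r / γ := by rwa [le_div_iff₀ hγ, neg_one_mul, ← not_lt]
    have hupper : r / γ ≤ 0 := div_nonpos_of_nonpos_of_nonneg h2 hγ.le
    rw [min_eq_right (by linarith), max_eq_right (by linarith)]
  · have : 0 < r / γ := div_pos (not_le.1 h2) hγ
    rw [min_eq_left (by linarith), max_eq_right zero_le_one]

lemma ramp_nonneg (hγ : 0 < γ) (r : ℝ) : 0 ≤ ramp γ r := by
  rw [ramp_eq hγ]
  exact le_max_left _ _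

lemma ramp_le_one (hγ : 0 < γ) (r : ℝ) : ramp γ r ≤ 1 := by
  rw [ramp_eq hγ]
  exact max_le zero_le_one (min_le_left _ _)

lemma ramp_eq_one (hγ : 0 < γ) {r : ℝ} (hr : 0 ≤ r) : ramp γ r = 1 := by
  have : 0 ≤ r / γ := by positivity
  rw [ramp_eq hγ, min_eq_left (by linarith), max_eq_right zero_le_one]

lemma ramp_mono_left (hγ' : 0 < γ') (h : γ' ≤ γ) (r : ℝ) : ramp γ' r ≤ ramp γ r := by
  have hγ : 0 < γ := hγ'.trans_le h
  rcases le_or_gt 0 r with hr | hr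
  · rw [ramp_eq_one hγ' hr, ramp_eq_one hγ hr]
  · rw [ramp_eq hγ, ramp_eq hγ']
    refine max_le_max le_rfl (min_le_min le_rfl (add_le_add le_rfl ?_))
    rw [div_le_div_iff₀ hγ' hγ]
    exact mul_le_mul_of_nonpos_left h hr.le

lemma abs_ramp_sub_le (hγ : 0 < γ) (r t : ℝ) : |ramp γ r - ramp γ t| ≤ |r - t| / γ := by
  rw [ramp_eq hγ, ramp_eq hγ, max_comm 0, max_comm 0]
  calc |max (min 1 (1 + r / γ)) 0 - max (min 1 (1 + t / γ)) 0|
      ≤ |min 1 (1 + r / γ) - min 1 (1 + t / γ)| := abs_max_sub_max_le_abs _ _ _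
    _ ≤ max |1 - 1| |1 + r / γ - (1 + t / γ)| := abs_min_sub_min_le_max _ _ _ _
    _ = |r - t| / γ := by
        rw [sub_self, abs_zero, max_eq_right (abs_nonneg _), add_sub_add_left_eq_sub, ← sub_div,
          abs_div, abs_of_pos hγ]

end Ramp

section Margin

variable {k : ℕ}

lemma nonempty_ne (hk : 2 ≤ k) (y : Fin k) : Nonempty {j : Fin k // j ≠ y} := by
  have : Nontrivial (Fin k) := Fin.nontrivial_iff_two_le.2 hk
  exact nonempty_subtype.2 (exists_ne y)

lemma abs_margin_sub_le (hk : 2 ≤ k) (v w : EuclideanSpace ℝ (Fin k)) (y : Fin k) :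
    |margin v y - margin w y| ≤ 2 * ‖v - w‖ := by
  have := nonempty_ne hk y
  have hcoord (j : Fin k) : |v j - w j| ≤ ‖v - w‖ := PiLp.norm_apply_le (v - w) j
  have hmax := abs_ciSup_sub_ciSup_le (a := fun j : {j : Fin k // j ≠ y} => v j)
    (b := fun j : {j : Fin k // j ≠ y} => w j) fun j => hcoord j
  calc |margin v y - margin w y|
      = |(v y - w y) - ((⨆ j : {j : Fin k // j ≠ y}, v j) -
          ⨆ j : {j : Fin k // j ≠ y}, w j)| := by rw [margin, margin, sub_sub_sub_comm]
    _ ≤ ‖v - w‖ + ‖v - w‖ := (abs_sub (v y - w y) _).trans (add_le_add (hcoord y) hmax)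
    _ = 2 * ‖v - w‖ := (two_mul _).symm

lemma abs_ramp_margin_sub_le (hk : 2 ≤ k) {γ : ℝ} (hγ : 0 < γ)
    (v w : EuclideanSpace ℝ (Fin k)) (y : Fin k) :
    |ramp γ (-margin v y) - ramp γ (-margin w y)| ≤ 2 / γ * ‖v - w‖ := by
  refine (abs_ramp_sub_le hγ _ _).trans ?_
  rw [neg_sub_neg, abs_sub_comm, div_mul_eq_mul_div]
  gcongr
  exact abs_margin_sub_le hk v w y

lemma empiricalRampRisk_mono {n q k : ℕ} {γ γ' : ℝ} (hγ' : 0 < γ') (h : γ' ≤ γ)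
    (f : EuclideanSpace ℝ (Fin q) → EuclideanSpace ℝ (Fin k))
    (S : Fin n → EuclideanSpace ℝ (Fin q) × Fin k) :
    empiricalRampRisk γ' f S ≤ empiricalRampRisk γ f S :=
  mul_le_mul_of_nonneg_left (Finset.sum_le_sum fun _ _ => ramp_mono_left hγ' h _) (by positivity)

lemma empiricalRampRisk_le_empiricalMarginError {n q k : ℕ} {γ : ℝ} (hγ : 0 < γ)
    (f : EuclideanSpace ℝ (Fin q) → EuclideanSpace ℝ (Fin k))
    (S : Fin n → EuclideanSpace ℝ (Fin q) × Fin k) :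
    empiricalRampRisk γ f S ≤ empiricalMarginError γ f S := by
  refine mul_le_mul_of_nonneg_left (Finset.sum_le_sum fun i _ => ?_) (by positivity)
  split_ifs with h
  · exact ramp_le_one hγ _
  · rw [ramp, if_pos]
    rw [margin]
    linarith

end Margin

section LossVector

variable {n k : ℕ}

/-- The vector of ramp losses of a sample of score vectors. -/
def lossVec (γ : ℝ) (y : Fin n → Fin k) (Z : DataSpace n k) : EuclideanSpace ℝ (Fin n) :=
  WithLp.toLp 2 fun i => ramp γ (-margin (Z i) (y i))

lemma norm_lossVec_sub_le (hk : 2 ≤ k) {γ : ℝ} (hγ : 0 < γ) (y : Fin n → Fin k)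
    (Y Z : DataSpace n k) : ‖lossVec γ y Y - lossVec γ y Z‖ ≤ 2 / γ * ‖Y - Z‖ := by
  refine (sq_le_sq₀ (norm_nonneg _) (by positivity)).1 ?_
  rw [mul_pow, EuclideanSpace.norm_sq_eq, PiLp.norm_sq_eq_of_L2, Finset.mul_sum]
  refine Finset.sum_le_sum fun i _ => ?_
  rw [← mul_pow]
  exact pow_le_pow_left₀ (norm_nonneg _) (abs_ramp_margin_sub_le hk hγ (Y i) (Z i) (y i)) 2

lemma norm_lossVec_le {γ : ℝ} (hγ : 0 < γ) (y : Fin n → Fin k) (Z : DataSpace n k) :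
    ‖lossVec γ y Z‖ ≤ √n := by
  refine Real.le_sqrt_of_sq_le ?_
  rw [EuclideanSpace.norm_sq_eq]
  calc ∑ i, ‖lossVec γ y Z i‖ ^ 2 ≤ ∑ _i : Fin n, (1 : ℝ) := by
        refine Finset.sum_le_sum fun i _ => pow_le_one₀ (norm_nonneg _) ?_
        rw [Real.norm_eq_abs, lossVec, abs_of_nonneg (ramp_nonneg hγ _)]
        exact ramp_le_one hγ _
    _ = n := by simp

end LossVector

section Rademacher

variable {L n : ℕ} {d : Fin (L + 1) → ℕ} {m : Fin L → ℕ} {σ : Nonlinearities d m}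
  {ρ : Fin L → NNReal} {M : Weights d m} {a s : Fin L → ℝ} {γ T : ℝ}

/-- The square root of the metric entropy, at scale one, of the ramp losses of the networks with
weights in `weightClass M a s`. The parameter `T` stands for the product of the Lipschitz
constants and the norm of the data. -/
def entropyRadius (W : ℕ) (γ T : ℝ) (a s : Fin L → ℝ) : ℝ :=
  2 / γ * T * √(2 * Real.log (2 * (W : ℝ) ^ 2) * complexitySum a s ^ 3)

lemma exists_lossVec_cover (hL : 1 ≤ L) (hk : 2 ≤ d (Fin.last L))
    (hσ : ∀ i, LipschitzWith (ρ i) (σ i)) (hσ0 : ∀ i, σ i 0 = 0)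
    (ha : ∀ i, 0 < a i) (hs : ∀ i, 0 < s i) (hγ : 0 < γ)
    (X : Fin n → EuclideanSpace ℝ (Fin (d 0))) (y : Fin n → Fin (d (Fin.last L)))
    (hT : 0 < T) (hTX : (∏ i, (ρ i : ℝ)) * dataNorm X ≤ T) {ε : ℝ} (hε : 0 < ε) :
    ∃ C : Finset (EuclideanSpace ℝ (Fin n)),
      Real.log C.card ≤ entropyRadius (width d m) γ T a s ^ 2 / ε ^ 2 ∧
      ∀ A ∈ weightClass M a s, ∃ c ∈ C, ‖lossVec γ y (layerData σ A X (Fin.last L)) - c‖ ≤ ε := by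
  classical
  have hW : 1 ≤ width d m := one_le_two.trans (hk.trans (le_width_left _))
  have hW' : (1 : ℝ) ≤ width d m := by exact_mod_cast hW
  have hlog : 0 ≤ Real.log (2 * (width d m : ℝ) ^ 2) := Real.log_nonneg (by nlinarith)
  have hU := complexitySum_nonneg (fun i => (ha i).le) fun i => (hs i).le
  obtain ⟨C, hC, hcover⟩ := exists_network_cover hL hW hσ hσ0 M ha hs X hT hTX
    (ε := ε * γ / 2) (by positivity)
  refine ⟨C.image (lossVec γ y), ?_, fun A hA => ?_⟩
  · refine (log_card_image_le_log_card _ _).trans (hC.trans_eq ?_)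
    rw [entropyRadius, mul_pow, Real.sq_sqrt (by positivity)]
    field_simp
  · obtain ⟨c, hc, hle⟩ := hcover A hA
    refine ⟨_, Finset.mem_image_of_mem _ hc, (norm_lossVec_sub_le hk hγ y _ _).trans ?_⟩
    calc 2 / γ * ‖layerData σ A X (Fin.last L) - c‖ ≤ 2 / γ * (ε * γ / 2) := by gcongr
      _ = ε := by field_simp

lemma natLog_mul_log_two_le (hn : 0 < n) : (Nat.log 2 n : ℝ) * Real.log 2 ≤ Real.log n := by
  rw [← Real.log_pow]
  exact Real.log_le_log (by positivity) (by exact_mod_cast Nat.pow_log_le_self 2 hn.ne')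

lemma sqrt_log_two_mul_sq_le {W : ℝ} (hW : 2 ≤ W) :
    √(2 * Real.log (2 * W ^ 2)) ≤ 2 * Real.log (2 * W) := by
  have hone : 1 ≤ Real.log (2 * W) := by
    rw [Real.le_log_iff_exp_le (by positivity)]
    linarith [Real.exp_one_lt_d9]
  have hle : Real.log (2 * W ^ 2) ≤ 2 * Real.log (2 * W) := by
    rw [← Real.log_rpow (by positivity), Real.rpow_two]
    exact Real.log_le_log (by positivity) (by nlinarith)
  rw [Real.sqrt_le_left (by positivity)]
  nlinarith

lemma natLog_mul_sqrt_le {W : ℝ} (hW : 2 ≤ W) (hn : 0 < n) :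
    24 * (Nat.log 2 n : ℝ) * √(2 * Real.log (2 * W ^ 2)) ≤
      72 * Real.log n * Real.log (2 * W) := by
  have hlog : 48 * (Nat.log 2 n : ℝ) ≤ 72 * Real.log n := by
    nlinarith [natLog_mul_log_two_le hn, Real.log_two_gt_d9, (Nat.log 2 n).cast_nonneg (α := ℝ)]
  have hlogW : 0 ≤ Real.log (2 * W) := Real.log_nonneg (by linarith)
  calc 24 * (Nat.log 2 n : ℝ) * √(2 * Real.log (2 * W ^ 2))
      ≤ 24 * (Nat.log 2 n : ℝ) * (2 * Real.log (2 * W)) := by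
        gcongr
        exact sqrt_log_two_mul_sq_le hW
    _ = 48 * (Nat.log 2 n : ℝ) * Real.log (2 * W) := by ring
    _ ≤ 72 * Real.log n * Real.log (2 * W) := by gcongr

lemma sqrt_pow_three {x : ℝ} (hx : 0 ≤ x) : √(x ^ 3) = x ^ (3 / 2 : ℝ) := by
  rw [Real.sqrt_eq_rpow, ← Real.rpow_natCast, ← Real.rpow_mul hx]
  norm_num

lemma natLog_mul_entropyRadius_le {W : ℕ} (hW : 2 ≤ W) (hn : 0 < n) (hγ : 0 < γ) (hT : 0 ≤ T)
    (ha : ∀ i, 0 ≤ a i) (hs : ∀ i, 0 ≤ s i) :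
    12 * entropyRadius W γ T a s * Nat.log 2 n ≤
      72 * Real.log n * Real.log (2 * W) * (T * complexitySum a s ^ (3 / 2 : ℝ) / γ) := by
  have hU := complexitySum_nonneg ha hs
  have : 0 ≤ complexitySum a s ^ (3 / 2 : ℝ) := Real.rpow_nonneg hU _
  have hW' : (2 : ℝ) ≤ W := by exact_mod_cast hW
  have hlog : 0 ≤ 2 * Real.log (2 * (W : ℝ) ^ 2) :=
    mul_nonneg zero_le_two (Real.log_nonneg (by nlinarith))
  calc 12 * entropyRadius W γ T a s * Nat.log 2 n
      = 24 * Nat.log 2 n * √(2 * Real.log (2 * (W : ℝ) ^ 2)) *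
          (T * complexitySum a s ^ (3 / 2 : ℝ) / γ) := by
        rw [entropyRadius, Real.sqrt_mul hlog, sqrt_pow_three hU]
        ring
    _ ≤ _ := mul_le_mul_of_nonneg_right (natLog_mul_sqrt_le hW' hn) (by positivity)

lemma rademacherAvg_lossVec_le (hL : 1 ≤ L) (hk : 2 ≤ d (Fin.last L))
    (hσ : ∀ i, LipschitzWith (ρ i) (σ i)) (hσ0 : ∀ i, σ i 0 = 0)
    (ha : ∀ i, 0 < a i) (hs : ∀ i, 0 < s i) {ι : Type*} [Finite ι] [Nonempty ι]
    {A : ι → Weights d m} (hA : ∀ i, A i ∈ weightClass M a s) (hγ : 0 < γ) (hn : 0 < n)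
    (X : Fin n → EuclideanSpace ℝ (Fin (d 0))) (y : Fin n → Fin (d (Fin.last L)))
    (hT : 0 < T) (hTX : (∏ i, (ρ i : ℝ)) * dataNorm X ≤ T) :
    2 * rademacherAvg (fun i k => lossVec γ y (layerData σ (A i) X (Fin.last L)) k) ≤
      4 + 72 * Real.log n * Real.log (2 * width d m) *
        (T * complexitySum a s ^ (3 / 2 : ℝ) / γ) := by
  have hn' : (0 : ℝ) < n := Nat.cast_pos.2 hn
  have hK : 0 ≤ entropyRadius (width d m) γ T a s := by
    unfold entropyRadius
    positivity
  have hdudley := rademacherAvg_le_of_entropy_le (R := √n) (by positivity) hK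
    (fun i => norm_lossVec_le hγ y (layerData σ (A i) X (Fin.last L)))
    (fun ε hε => by
      obtain ⟨C, hC, hcover⟩ :=
        exists_lossVec_cover (M := M) hL hk hσ hσ0 ha hs hγ X y hT hTX hε
      exact ⟨C, hC, fun i => hcover _ (hA i)⟩) (Nat.log 2 n)
  have hscale : √(Fintype.card (Fin n)) * (√n / 2 ^ Nat.log 2 n) ≤ 2 := by
    rw [Fintype.card_fin, ← mul_div_assoc, Real.mul_self_sqrt hn'.le,
      div_le_iff₀ (by positivity), ← pow_succ']
    exact_mod_cast (Nat.lt_pow_succ_log_self one_lt_two n).le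
  have hentropy := natLog_mul_entropyRadius_le (hk.trans (le_width_left (d := d) (m := m) _)) hn hγ
    hT.le (fun i => (ha i).le) fun i => (hs i).le
  linarith

lemma le_add_mul_of_forall_pos {a b c t : ℝ} (hc : 0 ≤ c)
    (h : ∀ η, 0 < η → a ≤ b + c * (t + η)) : a ≤ b + c * t := by
  refine le_of_forall_pos_le_add fun ε hε => (h (ε / (c + 1)) (by positivity)).trans ?_
  have hε' : c * (ε / (c + 1)) ≤ ε := by
    rw [← mul_div_assoc, div_le_iff₀ (by positivity)]
    nlinarith
  linarith

lemma rademacherAvg_network_le (hL : 1 ≤ L) (hk : 2 ≤ d (Fin.last L))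
    (hσ : ∀ i, LipschitzWith (ρ i) (σ i)) (hσ0 : ∀ i, σ i 0 = 0)
    (ha : ∀ i, 0 < a i) (hs : ∀ i, 0 < s i) {ι : Type*} [Finite ι] [Nonempty ι]
    {A : ι → Weights d m} (hA : ∀ i, A i ∈ weightClass M a s) (hγ : 0 < γ) (hn : 0 < n)
    (X : Fin n → EuclideanSpace ℝ (Fin (d 0))) (y : Fin n → Fin (d (Fin.last L))) :
    2 / n * rademacherAvg (fun i k => ramp γ (-margin (network σ (A i) (X k)) (y k))) ≤
      4 / n + 72 * Real.log n * Real.log (2 * width d m) / (γ * n) *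
        complexitySum a s ^ (3 / 2 : ℝ) * ((∏ i, (ρ i : ℝ)) * dataNorm X) := by
  have hW : (2 : ℝ) ≤ width d m := by exact_mod_cast hk.trans (le_width_left _)
  have hpow : 0 ≤ complexitySum a s ^ (3 / 2 : ℝ) :=
    Real.rpow_nonneg (complexitySum_nonneg (fun i => (ha i).le) fun i => (hs i).le) _
  have : 0 ≤ Real.log n := Real.log_natCast_nonneg n
  have hlogW : 0 ≤ Real.log (2 * width d m) := Real.log_nonneg (by linarith)
  have hX : 0 ≤ (∏ i, (ρ i : ℝ)) * dataNorm X :=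
    mul_nonneg (Finset.prod_nonneg fun i _ => (ρ i).2) (Real.sqrt_nonneg _)
  refine le_add_mul_of_forall_pos (by positivity) fun η hη => ?_
  have hle := rademacherAvg_lossVec_le hL hk hσ hσ0 ha hs hA hγ hn X y
    (T := (∏ i, (ρ i : ℝ)) * dataNorm X + η) (by positivity) (by linarith)
  calc _ = (2 * rademacherAvg fun i k =>
          lossVec γ y (layerData σ (A i) X (Fin.last L)) k) / n := div_mul_eq_mul_div _ _ _
    _ ≤ _ := div_le_div_of_nonneg_right hle n.cast_nonneg
    _ = _ := by ring

end Rademacher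

/-! ### Uniform deviation over a class of weights -/

section ClassBound

lemma measure_iUnion_le_of_forall_finset {T Ω : Type*} [TopologicalSpace T]
    [TopologicalSpace.SeparableSpace T] [MeasurableSpace Ω] {P : Measure Ω} {c : ENNReal}
    {U : T → Set Ω} (hU : ∀ S, IsOpen {t | S ∈ U t})
    (h : ∀ F : Finset T, P (⋃ t ∈ F, U t) ≤ c) : P (⋃ t, U t) ≤ c := by
  classical
  rcases isEmpty_or_nonempty T with _ | _
  · simp
  let D : ℕ → T := TopologicalSpace.denseSeq T
  have hdense : ⋃ t, U t = ⋃ N, U (D N) := by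
    refine Set.Subset.antisymm (Set.iUnion_subset fun t S hS => ?_)
      (Set.iUnion_subset fun N => Set.subset_iUnion U (D N))
    obtain ⟨N, hN⟩ := (TopologicalSpace.denseRange_denseSeq T).exists_mem_open (hU S) ⟨t, hS⟩
    exact Set.mem_iUnion.2 ⟨N, hN⟩
  rw [hdense, measure_iUnion_eq_iSup_accumulate]
  refine iSup_le fun N => (measure_mono ?_).trans (h ((Finset.range (N + 1)).image D))
  refine Set.iUnion₂_subset fun j hj => Set.subset_biUnion_of_mem (u := U) ?_
  exact Finset.mem_image_of_mem D (Finset.mem_range_succ_iff.2 hj)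

variable {L n : ℕ} {d : Fin (L + 1) → ℕ} {m : Fin L → ℕ} {σ : Nonlinearities d m}
  {ρ : Fin L → NNReal} {M : Weights d m} {a s : Fin L → ℝ} {γ : ℝ}

lemma continuous_layerOutput (hσ : ∀ i, Continuous (σ i)) (i : Fin (L + 1)) :
    Continuous fun q : Weights d m × EuclideanSpace ℝ (Fin (d 0)) => layerOutput σ q.1 q.2 i := by
  induction i using Fin.induction with
  | zero => exact continuous_snd
  | succ i ih =>
    simp_rw [layerOutput_succ]
    refine (hσ i).comp ((PiLp.continuous_toLp 2 _).comp (Continuous.matrix_mulVec ?_ ?_))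
    · exact (continuous_apply i).comp continuous_fst
    · exact (PiLp.continuous_ofLp 2 _).comp ih

instance : SecondCountableTopology (Weights d m) :=
  have (i : Fin L) : SecondCountableTopology (Matrix (Fin (m i)) (Fin (d i.castSucc)) ℝ) :=
    inferInstanceAs (SecondCountableTopology (Fin (m i) → Fin (d i.castSucc) → ℝ))
  inferInstance

/-- The ramp loss of the network with weights `A` on a labelled point. -/
def netLoss (σ : Nonlinearities d m) (γ : ℝ) (A : Weights d m)
    (z : EuclideanSpace ℝ (Fin (d 0)) × Fin (d (Fin.last L))) : ℝ :=
  ramp γ (-margin (network σ A z.1) z.2)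

lemma netLoss_mem_Icc (hγ : 0 < γ) (A : Weights d m)
    (z : EuclideanSpace ℝ (Fin (d 0)) × Fin (d (Fin.last L))) :
    netLoss σ γ A z ∈ Set.Icc 0 1 :=
  ⟨ramp_nonneg hγ _, ramp_le_one hγ _⟩

lemma continuous_ramp_margin {k : ℕ} (hk : 2 ≤ k) (hγ : 0 < γ) (y : Fin k) :
    Continuous fun v : EuclideanSpace ℝ (Fin k) => ramp γ (-margin v y) := by
  refine (LipschitzWith.of_dist_le_mul (K := ⟨2 / γ, by positivity⟩) fun v w => ?_).continuous
  rw [Real.dist_eq, dist_eq_norm]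
  exact abs_ramp_margin_sub_le hk hγ v w y

lemma continuous_netLoss (hk : 2 ≤ d (Fin.last L)) (hσ : ∀ i, Continuous (σ i)) (hγ : 0 < γ)
    (z : EuclideanSpace ℝ (Fin (d 0)) × Fin (d (Fin.last L))) :
    Continuous fun A => netLoss σ γ A z :=
  (continuous_ramp_margin hk hγ z.2).comp
    ((continuous_layerOutput hσ (Fin.last L)).comp (continuous_id.prodMk continuous_const))

lemma measurable_netLoss (hk : 2 ≤ d (Fin.last L)) (hσ : ∀ i, Continuous (σ i)) (hγ : 0 < γ)
    (A : Weights d m) : Measurable (netLoss σ γ A) :=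
  measurable_from_prod_countable_left fun y =>
    ((continuous_ramp_margin hk hγ y).comp ((continuous_layerOutput hσ (Fin.last L)).comp
      (continuous_const.prodMk continuous_id))).measurable

lemma continuous_empiricalRampRisk_network (hk : 2 ≤ d (Fin.last L))
    (hσ : ∀ i, Continuous (σ i)) (hγ : 0 < γ)
    (S : Fin n → EuclideanSpace ℝ (Fin (d 0)) × Fin (d (Fin.last L))) :
    Continuous fun A => empiricalRampRisk γ (network σ A) S :=
  continuous_const.mul (continuous_finsetSum _ fun i _ => continuous_netLoss hk hσ hγ (S i))

variable {μ : Measure (EuclideanSpace ℝ (Fin (d 0)) × Fin (d (Fin.last L)))}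

lemma integrable_netLoss [IsFiniteMeasure μ] (hk : 2 ≤ d (Fin.last L))
    (hσ : ∀ i, Continuous (σ i)) (hγ : 0 < γ) (A : Weights d m) :
    Integrable (netLoss σ γ A) μ :=
  .of_mem_Icc 0 1 (measurable_netLoss hk hσ hγ A).aemeasurable
    (Eventually.of_forall (netLoss_mem_Icc hγ A))

lemma continuous_integral_netLoss [IsFiniteMeasure μ] (hk : 2 ≤ d (Fin.last L))
    (hσ : ∀ i, Continuous (σ i)) (hγ : 0 < γ) :
    Continuous fun A => ∫ z, netLoss σ γ A z ∂μ := by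
  refine continuous_of_dominated (bound := fun _ => 1)
    (fun A => (measurable_netLoss hk hσ hγ A).aestronglyMeasurable)
    (fun A => Eventually.of_forall fun z => ?_) (integrable_const _)
    (Eventually.of_forall fun z => continuous_netLoss hk hσ hγ z)
  obtain ⟨hnonneg, hle⟩ := netLoss_mem_Icc (σ := σ) hγ A z
  rwa [Real.norm_eq_abs, abs_of_nonneg hnonneg]

/-- The complexity term in the uniform deviation bound for the networks with weights in
`weightClass M a s`. The parameter `B` stands for the norm of the data. -/
def classExcess (ρ : Fin L → NNReal) (d : Fin (L + 1) → ℕ) (m : Fin L → ℕ)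
    (a s : Fin L → ℝ) (n : ℕ) (γ B : ℝ) : ℝ :=
  4 / n + 72 * Real.log n * Real.log (2 * width d m) / (γ * n) *
    complexitySum a s ^ (3 / 2 : ℝ) * ((∏ i, (ρ i : ℝ)) * B)

/-- The samples for which the true ramp risk of the network with weights `A` exceeds its empirical
ramp risk by more than `classExcess` plus `t`. -/
def deviationEvent (σ : Nonlinearities d m) (ρ : Fin L → NNReal) (a s : Fin L → ℝ) (n : ℕ)
    (γ : ℝ) (μ : Measure (EuclideanSpace ℝ (Fin (d 0)) × Fin (d (Fin.last L)))) (t : ℝ)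
    (A : Weights d m) : Set (Fin n → EuclideanSpace ℝ (Fin (d 0)) × Fin (d (Fin.last L))) :=
  {S | empiricalRampRisk γ (network σ A) S +
    classExcess ρ d m a s n γ (dataNorm fun i => (S i).1) + t < ∫ z, netLoss σ γ A z ∂μ}

lemma isOpen_setOf_mem_deviationEvent [IsFiniteMeasure μ] (hk : 2 ≤ d (Fin.last L))
    (hσ : ∀ i, Continuous (σ i)) (hγ : 0 < γ) (t : ℝ)
    (S : Fin n → EuclideanSpace ℝ (Fin (d 0)) × Fin (d (Fin.last L))) :
    IsOpen {A | S ∈ deviationEvent σ ρ a s n γ μ t A} :=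
  isOpen_lt (((continuous_empiricalRampRisk_network hk hσ hγ S).add continuous_const).add
    continuous_const) (continuous_integral_netLoss hk hσ hγ)

variable [IsProbabilityMeasure μ]

lemma measure_biUnion_finset_deviationEvent_le (hL : 1 ≤ L) (hk : 2 ≤ d (Fin.last L))
    (hσ : ∀ i, LipschitzWith (ρ i) (σ i)) (hσ0 : ∀ i, σ i 0 = 0) (ha : ∀ i, 0 < a i)
    (hs : ∀ i, 0 < s i) (hγ : 0 < γ) (hn : 0 < n) {t : ℝ} (ht : 0 ≤ t)
    (F : Finset (weightClass M a s)) :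
    (Measure.pi fun _ : Fin n => μ) (⋃ A ∈ F, deviationEvent σ ρ a s n γ μ t A) ≤
      ENNReal.ofReal (Real.exp (-(2 * n * t ^ 2 / 9))) := by
  rcases F.eq_empty_or_nonempty with rfl | hF
  · simp
  have : Nonempty F := hF.to_subtype
  refine (measure_mono ?_).trans (measure_exists_deviation_le μ
    (f := fun A : F => netLoss σ γ (A : weightClass M a s))
    (fun A => measurable_netLoss hk (fun i => (hσ i).continuous) hγ _)
    (fun A => netLoss_mem_Icc hγ _) hn ht)
  refine Set.iUnion₂_subset fun A hA S hS => ⟨⟨A, hA⟩, lt_of_le_of_lt ?_ hS⟩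
  gcongr
  · exact le_rfl
  · exact rademacherAvg_network_le hL hk hσ hσ0 ha hs
      (A := fun A : F => ((A : weightClass M a s) : Weights d m)) (fun A => A.1.2) hγ hn
      (fun i => (S i).1) fun i => (S i).2

lemma measure_iUnion_deviationEvent_le (hL : 1 ≤ L) (hk : 2 ≤ d (Fin.last L))
    (hσ : ∀ i, LipschitzWith (ρ i) (σ i)) (hσ0 : ∀ i, σ i 0 = 0) (ha : ∀ i, 0 < a i)
    (hs : ∀ i, 0 < s i) (hγ : 0 < γ) (hn : 0 < n) {t : ℝ} (ht : 0 ≤ t) :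
    (Measure.pi fun _ : Fin n => μ) (⋃ A ∈ weightClass M a s, deviationEvent σ ρ a s n γ μ t A) ≤
      ENNReal.ofReal (Real.exp (-(2 * n * t ^ 2 / 9))) := by
  rw [Set.biUnion_eq_iUnion]
  refine measure_iUnion_le_of_forall_finset (fun S => ?_)
    (measure_biUnion_finset_deviationEvent_le hL hk hσ hσ0 ha hs hγ hn ht)
  exact (isOpen_setOf_mem_deviationEvent hk (fun i => (hσ i).continuous) hγ t S).preimage
    continuous_subtype_val

end ClassBound

/-! ### A weighted grid of parameters -/

section Grid

lemma tsum_mul_le_one {α β : Type*} {u : α → ENNReal} {v : β → ENNReal} (hu : ∑' x, u x ≤ 1)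
    (hv : ∑' y, v y ≤ 1) : ∑' z : α × β, u z.1 * v z.2 ≤ 1 := by
  rw [ENNReal.tsum_prod']
  simp_rw [ENNReal.tsum_mul_left, ENNReal.tsum_mul_right]
  exact mul_le_one' hu hv

lemma tsum_prod_le_one {α : Type*} {v : α → ENNReal} (hv : ∑' x, v x ≤ 1) (L : ℕ) :
    ∑' f : Fin L → α, ∏ i, v (f i) ≤ 1 := by
  induction L with
  | zero => simp
  | succ L ih =>
    rw [← (Fin.consEquiv fun _ : Fin (L + 1) => α).tsum_eq]
    simp only [Fin.consEquiv_apply, Fin.prod_univ_succ, Fin.cons_zero, Fin.cons_succ]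
    exact tsum_mul_le_one hv ih

/-- Positive weights on the integers with sum at most one, decaying geometrically. -/
def intWeight (j : ℤ) : ℝ := (1 / 2) ^ j.natAbs / 4

/-- Positive weights on the natural numbers with sum one, decaying quadratically. -/
def natWeight (p : ℕ) : ℝ := 1 / ((p + 1) * (p + 2))

lemma intWeight_pos (j : ℤ) : 0 < intWeight j := by unfold intWeight; positivity

lemma natWeight_pos (p : ℕ) : 0 < natWeight p := by unfold natWeight; positivity

lemma hasSum_intWeight : HasSum intWeight (3 / 4) := by
  have hgeom := hasSum_geometric_two.div_const 4
  have hnonneg : HasSum (fun p : ℕ => intWeight p) (2 / 4) := hgeom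
  have hneg : HasSum (fun p : ℕ => intWeight (-(p + 1 : ℤ))) (1 / 2 * (2 / 4)) := by
    refine (hgeom.mul_left (1 / 2)).congr_fun fun p => ?_
    rw [intWeight, show (-(p + 1 : ℤ)).natAbs = p + 1 by omega]
    ring
  convert HasSum.of_nat_of_neg_add_one hnonneg hneg using 1
  norm_num

lemma tsum_intWeight_le_one : ∑' j, ENNReal.ofReal (intWeight j) ≤ 1 := by
  rw [← ENNReal.ofReal_tsum_of_nonneg (fun j => (intWeight_pos j).le) hasSum_intWeight.summable,
    hasSum_intWeight.tsum_eq, ENNReal.ofReal_le_one]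
  norm_num

lemma sum_range_natWeight (N : ℕ) :
    ∑ p ∈ Finset.range N, natWeight p = 1 - 1 / ((N : ℝ) + 1) := by
  induction N with
  | zero => simp
  | succ N ih =>
    rw [Finset.sum_range_succ, ih, natWeight]
    push_cast
    field_simp
    ring

lemma tsum_natWeight_le_one : ∑' p, ENNReal.ofReal (natWeight p) ≤ 1 := by
  refine ENNReal.tsum_le_of_sum_range_le fun N => ?_
  rw [← ENNReal.ofReal_sum_of_nonneg fun p _ => (natWeight_pos p).le, ENNReal.ofReal_le_one,
    sum_range_natWeight, sub_le_self_iff]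
  positivity

lemma neg_log_intWeight (j : ℤ) :
    -Real.log (intWeight j) = |(j : ℝ)| * Real.log 2 + 2 * Real.log 2 := by
  have hfour : Real.log 4 = 2 * Real.log 2 := by
    rw [show (4 : ℝ) = 2 ^ 2 by norm_num, Real.log_pow, Nat.cast_two]
  rw [intWeight, Real.log_div (by positivity) four_ne_zero, Real.log_pow, one_div, Real.log_inv,
    hfour, Nat.cast_natAbs, Int.cast_abs]
  ring

lemma exists_zpow_le_and_neg_log_intWeight_le {q : ℝ} (hq : 0 < q) :
    ∃ j : ℤ, (2 : ℝ) ^ j ≤ q ∧ q ≤ 2 * 2 ^ j ∧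
      -Real.log (intWeight j) ≤ |Real.log q| + 3 * Real.log 2 := by
  obtain ⟨j, hle, hlt⟩ := exists_mem_Ico_zpow hq one_lt_two
  have hlog_le : j * Real.log 2 ≤ Real.log q := by
    rw [← Real.log_zpow]
    exact Real.log_le_log (by positivity) hle
  have hlog_lt : Real.log q ≤ (j + 1) * Real.log 2 := by
    rw [← Int.cast_one, ← Int.cast_add, ← Real.log_zpow]
    exact Real.log_le_log hq hlt.le
  have habs : |(j : ℝ)| * Real.log 2 ≤ |Real.log q| + Real.log 2 := by
    have hlog2 : 0 < Real.log 2 := Real.log_pos one_lt_two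
    rw [← abs_of_pos hlog2, ← abs_mul, abs_of_pos hlog2, abs_le]
    constructor <;> linarith [le_abs_self (Real.log q), neg_abs_le (Real.log q)]
  rw [zpow_add_one₀ two_ne_zero, mul_comm] at hlt
  refine ⟨j, hle, hlt.le, ?_⟩
  rw [neg_log_intWeight]
  linarith

lemma exists_nat_div_and_neg_log_natWeight_le {L : ℕ} (hL : 1 ≤ L) {r : ℝ} (hr : 0 ≤ r) :
    ∃ p : ℕ, r ≤ (p + 1) / L ∧ ((p : ℝ) + 1) / L ≤ 1 / L + r ∧
      -Real.log (natWeight p) ≤ 2 * Real.log (2 + L * r) := by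
  have hL' : (0 : ℝ) < L := by exact_mod_cast hL
  have hfloor : (⌊L * r⌋₊ : ℝ) ≤ L * r := Nat.floor_le (by positivity)
  have hlt : L * r < (⌊L * r⌋₊ : ℝ) + 1 := Nat.lt_floor_add_one _
  refine ⟨⌊L * r⌋₊, ?_, ?_, ?_⟩
  · rw [le_div_iff₀ hL']
    linarith
  · rw [div_le_iff₀ hL', add_mul, one_div, inv_mul_cancel₀ hL'.ne']
    linarith
  · rw [natWeight, one_div, Real.log_inv, neg_neg, ← Nat.cast_ofNat (R := ℝ) (n := 2),
      ← Real.log_pow]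
    refine Real.log_le_log (by positivity) ?_
    push_cast
    nlinarith

/-- Indices `(j, p, q)` of the values over which the union bound is taken: `n * 2 ^ j` for the
margin, `gridRadius p` for the distances to the reference matrices and `gridRadius q` for the
spectral norms. -/
abbrev Grid (L : ℕ) : Type := ℤ × (Fin L → ℕ) × (Fin L → ℕ)

variable {L : ℕ}

/-- The bounds, in multiples of `1 / L`, that are indexed by a vector of natural numbers. -/
def gridRadius (p : Fin L → ℕ) (i : Fin L) : ℝ := ((p i : ℝ) + 1) / L

lemma gridRadius_pos (hL : 1 ≤ L) (p : Fin L → ℕ) (i : Fin L) : 0 < gridRadius p i := by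
  have : (0 : ℝ) < L := by exact_mod_cast hL
  unfold gridRadius
  positivity

/-- Positive weights on the grid with sum at most one. -/
def gridWeight (g : Grid L) : ℝ :=
  intWeight g.1 * ((∏ i, natWeight (g.2.1 i)) * ∏ i, natWeight (g.2.2 i))

lemma gridWeight_pos (g : Grid L) : 0 < gridWeight g :=
  mul_pos (intWeight_pos _) (mul_pos (Finset.prod_pos fun _ _ => natWeight_pos _)
    (Finset.prod_pos fun _ _ => natWeight_pos _))

lemma tsum_gridWeight_le_one (L : ℕ) : ∑' g : Grid L, ENNReal.ofReal (gridWeight g) ≤ 1 := by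
  have hprod (p : Fin L → ℕ) : 0 ≤ ∏ i, natWeight (p i) :=
    Finset.prod_nonneg fun _ _ => (natWeight_pos _).le
  simp_rw [gridWeight, ENNReal.ofReal_mul (intWeight_pos _).le, ENNReal.ofReal_mul (hprod _),
    ENNReal.ofReal_prod_of_nonneg fun _ _ => (natWeight_pos _).le]
  have hnat := tsum_prod_le_one tsum_natWeight_le_one L
  exact tsum_mul_le_one tsum_intWeight_le_one (tsum_mul_le_one hnat hnat)

lemma gridWeight_le_one (g : Grid L) : gridWeight g ≤ 1 :=
  ENNReal.ofReal_le_one.1 ((ENNReal.le_tsum g).trans (tsum_gridWeight_le_one L))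

lemma neg_log_gridWeight (g : Grid L) :
    -Real.log (gridWeight g) = -Real.log (intWeight g.1) + ∑ i, -Real.log (natWeight (g.2.1 i)) +
      ∑ i, -Real.log (natWeight (g.2.2 i)) := by
  have hprod (p : Fin L → ℕ) : ∏ i, natWeight (p i) ≠ 0 :=
    (Finset.prod_pos fun _ _ => natWeight_pos _).ne'
  rw [gridWeight, Real.log_mul (intWeight_pos _).ne' (mul_ne_zero (hprod _) (hprod _)),
    Real.log_mul (hprod _) (hprod _), Real.log_prod fun i _ => (natWeight_pos _).ne',
    Real.log_prod fun i _ => (natWeight_pos _).ne', Finset.sum_neg_distrib,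
    Finset.sum_neg_distrib]
  ring

end Grid

/-! ### The generalization bound -/

section Generalization

lemma measure_iUnion_le_of_forall_le_mul {ι Ω : Type*} [Countable ι] [MeasurableSpace Ω]
    {P : Measure Ω} {U : ι → Set Ω} {w : ι → ENNReal} {c : ENNReal}
    (h : ∀ i, P (U i) ≤ c * w i) (hw : ∑' i, w i ≤ 1) : P (⋃ i, U i) ≤ c :=
  calc P (⋃ i, U i) ≤ ∑' i, P (U i) := measure_iUnion_le _
    _ ≤ ∑' i, c * w i := ENNReal.tsum_le_tsum h
    _ = c * ∑' i, w i := ENNReal.tsum_mul_left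
    _ ≤ c := mul_le_of_le_one_right' hw

variable {L n : ℕ} {d : Fin (L + 1) → ℕ} {m : Fin L → ℕ} {σ : Nonlinearities d m}
  {ρ : Fin L → NNReal} {M A : Weights d m} {δ γ B : ℝ}

lemma norm21_nonneg {p q : ℕ} (A : Matrix (Fin p) (Fin q) ℝ) : 0 ≤ norm21 A :=
  Finset.sum_nonneg fun _ _ => Real.sqrt_nonneg _

/-- The distances `a i` of the weight matrices to the reference matrices. -/
def refDist (M A : Weights d m) (i : Fin L) : ℝ :=
  norm21 ((A i).transpose - (M i).transpose)

lemma refDist_nonneg (M A : Weights d m) (i : Fin L) : 0 ≤ refDist M A i :=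
  norm21_nonneg _

/-- The complexity sum of the distances and the spectral norms, all increased by `1 / L`. -/
def shiftedComplexity (M A : Weights d m) : ℝ :=
  complexitySum (fun i => 1 / (L : ℝ) + refDist M A i) fun i => 1 / (L : ℝ) + spectralNorm (A i)

lemma shiftedComplexity_nonneg (M A : Weights d m) : 0 ≤ shiftedComplexity M A :=
  complexitySum_nonneg (fun i => add_nonneg (by positivity) (refDist_nonneg M A i)) fun i =>
    add_nonneg (by positivity) (spectralNorm_nonneg (A i))

/-- The sum of logarithms under the square root in `excess`. -/
def confidenceLog (M : Weights d m) (δ : ℝ) (n : ℕ) (γ B : ℝ) (A : Weights d m) : ℝ :=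
  Real.log (1 / δ) + (Real.log 2 + |Real.log (n / γ)|) + 2 * Real.log (2 + B) +
    2 * ∑ i, Real.log (2 + L * refDist M A i) + 2 * ∑ i, Real.log (2 + L * spectralNorm (A i))

lemma excess_eq (ρ : Fin L → NNReal) (M : Weights d m) (δ : ℝ) (n : ℕ) (γ B : ℝ)
    (A : Weights d m) :
    excess ρ M δ n γ B A = 8 / n +
      144 * Real.log n * Real.log (2 * width d m) / (γ * n) * (∏ i, (ρ i : ℝ)) * (1 + B) *
        shiftedComplexity M A ^ (3 / 2 : ℝ) +
      √(9 / (2 * n)) * √(confidenceLog M δ n γ B A) :=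
  rfl

lemma classExcess_add_le_excess (hW : 1 ≤ width d m) (hn : 0 < n) {γ' ℓ : ℝ} (hγ' : 0 < γ')
    (hγγ' : γ ≤ 2 * γ') (hγ : 0 < γ) (hB : 0 ≤ B) {a s : Fin L → ℝ} (ha : ∀ i, 0 ≤ a i)
    (hs : ∀ i, 0 ≤ s i) (haA : ∀ i, a i ≤ 1 / L + refDist M A i)
    (hsA : ∀ i, s i ≤ 1 / L + spectralNorm (A i)) (hℓ : ℓ ≤ confidenceLog M δ n γ B A) :
    classExcess ρ d m a s n γ' B + √(9 / (2 * n)) * √ℓ ≤ excess ρ M δ n γ B A := by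
  have : (0 : ℝ) < n := by exact_mod_cast hn
  have hW' : (1 : ℝ) ≤ width d m := by exact_mod_cast hW
  have : 0 ≤ Real.log n := Real.log_natCast_nonneg n
  have hlogW : 0 ≤ Real.log (2 * width d m) := Real.log_nonneg (by linarith)
  have : 0 ≤ ∏ i, (ρ i : ℝ) := Finset.prod_nonneg fun i _ => (ρ i).2
  have hU : complexitySum a s ^ (3 / 2 : ℝ) ≤ shiftedComplexity M A ^ (3 / 2 : ℝ) :=
    Real.rpow_le_rpow (complexitySum_nonneg ha hs) (complexitySum_mono ha hs haA hsA)
      (by norm_num)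
  have hU0 : 0 ≤ complexitySum a s ^ (3 / 2 : ℝ) := Real.rpow_nonneg (complexitySum_nonneg ha hs) _
  have hU' : 0 ≤ shiftedComplexity M A ^ (3 / 2 : ℝ) :=
    Real.rpow_nonneg (shiftedComplexity_nonneg M A) _
  have hcoef : 72 * Real.log n * Real.log (2 * width d m) / (γ' * n) ≤
      144 * Real.log n * Real.log (2 * width d m) / (γ * n) := by
    rw [div_le_div_iff₀ (by positivity) (by positivity)]
    have hnonneg : 0 ≤ Real.log n * Real.log (2 * width d m) * n := by positivity
    nlinarith
  rw [excess_eq, classExcess]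
  refine add_le_add (add_le_add (by gcongr; norm_num) ?_) (by gcongr)
  calc _ ≤ 144 * Real.log n * Real.log (2 * width d m) / (γ * n) *
        shiftedComplexity M A ^ (3 / 2 : ℝ) * ((∏ i, (ρ i : ℝ)) * (1 + B)) := by
        gcongr
        linarith
    _ = _ := by ring

lemma netLoss_eq_one_of_ne (hγ : 0 < γ)
    {c : EuclideanSpace ℝ (Fin (d 0)) → Fin (d (Fin.last L))}
    (hc : ∀ x j, network σ A x j ≤ network σ A x (c x))
    {z : EuclideanSpace ℝ (Fin (d 0)) × Fin (d (Fin.last L))} (hz : c z.1 ≠ z.2) :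
    netLoss σ γ A z = 1 := by
  refine ramp_eq_one hγ ?_
  rw [margin, neg_sub, sub_nonneg]
  exact (hc z.1 z.2).trans (le_ciSup
    (f := fun j : {j : Fin (d (Fin.last L)) // j ≠ z.2} => network σ A z.1 j)
    (Set.finite_range _).bddAbove ⟨c z.1, hz⟩)

variable {μ : Measure (EuclideanSpace ℝ (Fin (d 0)) × Fin (d (Fin.last L)))}
  [IsProbabilityMeasure μ]

lemma measureReal_ne_le_integral_netLoss (hk : 2 ≤ d (Fin.last L)) (hσ : ∀ i, Continuous (σ i))
    (hγ : 0 < γ) {c : EuclideanSpace ℝ (Fin (d 0)) → Fin (d (Fin.last L))}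
    (hc : ∀ x j, network σ A x j ≤ network σ A x (c x)) :
    μ.real {z | c z.1 ≠ z.2} ≤ ∫ z, netLoss σ γ A z ∂μ :=
  calc μ.real {z | c z.1 ≠ z.2} ≤ μ.real {z | 1 ≤ netLoss σ γ A z} :=
        measureReal_mono fun _ hz => (netLoss_eq_one_of_ne hγ hc hz).ge
    _ = 1 * μ.real {z | 1 ≤ netLoss σ γ A z} := (one_mul _).symm
    _ ≤ ∫ z, netLoss σ γ A z ∂μ := mul_meas_ge_le_integral_of_nonneg
        (Eventually.of_forall fun z => (netLoss_mem_Icc hγ A z).1)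
        (integrable_netLoss hk hσ hγ A) 1

/-- The logarithm of the inverse of the share of the confidence `δ` that is spent at `g`. -/
def gridLog (δ : ℝ) (g : Grid L) : ℝ := Real.log (1 / δ) + -Real.log (gridWeight g)

lemma exists_grid (hL : 1 ≤ L) (hn : 0 < n) (hγ : 0 < γ) (hB : 0 ≤ B) (δ : ℝ)
    (M A : Weights d m) :
    ∃ g : Grid L, n * (2 : ℝ) ^ g.1 ≤ γ ∧ γ ≤ 2 * (n * (2 : ℝ) ^ g.1) ∧
      A ∈ weightClass M (gridRadius g.2.1) (gridRadius g.2.2) ∧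
      (∀ i, gridRadius g.2.1 i ≤ 1 / L + refDist M A i) ∧
      (∀ i, gridRadius g.2.2 i ≤ 1 / L + spectralNorm (A i)) ∧
      gridLog δ g ≤ confidenceLog M δ n γ B A := by
  have hn' : (0 : ℝ) < n := by exact_mod_cast hn
  obtain ⟨j, hj_le, hle_j, hj⟩ := exists_zpow_le_and_neg_log_intWeight_le (div_pos hγ hn')
  choose p hle_p hp_le hp using fun i =>
    exists_nat_div_and_neg_log_natWeight_le hL (refDist_nonneg M A i)
  choose q hle_q hq_le hq using fun i =>
    exists_nat_div_and_neg_log_natWeight_le hL (spectralNorm_nonneg (A i))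
  rw [le_div_iff₀ hn', mul_comm] at hj_le
  rw [div_le_iff₀ hn', mul_assoc, mul_comm _ (n : ℝ)] at hle_j
  rw [← inv_div, Real.log_inv, abs_neg] at hj
  refine ⟨(j, p, q), hj_le, hle_j, fun i => ⟨hle_q i, hle_p i⟩, hp_le, hq_le, ?_⟩
  have hsum_p := Finset.sum_le_sum fun i (_ : i ∈ Finset.univ) => hp i
  have hsum_q := Finset.sum_le_sum fun i (_ : i ∈ Finset.univ) => hq i
  have hlogB : Real.log 2 ≤ Real.log (2 + B) := Real.log_le_log two_pos (by linarith)
  rw [← Finset.mul_sum] at hsum_p hsum_q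
  rw [gridLog, neg_log_gridWeight, confidenceLog]
  linarith

/-- The samples that violate the uniform deviation bound for the class of networks belonging to
the grid index `g`. -/
def gridEvent (σ : Nonlinearities d m) (ρ : Fin L → NNReal) (M : Weights d m) (δ : ℝ) (n : ℕ)
    (μ : Measure (EuclideanSpace ℝ (Fin (d 0)) × Fin (d (Fin.last L)))) (g : Grid L) :
    Set (Fin n → EuclideanSpace ℝ (Fin (d 0)) × Fin (d (Fin.last L))) :=
  ⋃ A ∈ weightClass M (gridRadius g.2.1) (gridRadius g.2.2),
    deviationEvent σ ρ (gridRadius g.2.1) (gridRadius g.2.2) n (n * 2 ^ g.1) μ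
      (√(9 / (2 * n)) * √(gridLog δ g)) A

lemma measure_gridEvent_le (hL : 1 ≤ L) (hk : 2 ≤ d (Fin.last L))
    (hσ : ∀ i, LipschitzWith (ρ i) (σ i)) (hσ0 : ∀ i, σ i 0 = 0) (hδ : 0 < δ) (hδ1 : δ < 1)
    (hn : 0 < n) (g : Grid L) :
    (Measure.pi fun _ : Fin n => μ) (gridEvent σ ρ M δ n μ g) ≤
      ENNReal.ofReal δ * ENNReal.ofReal (gridWeight g) := by
  have : (0 : ℝ) < n := by exact_mod_cast hn
  have hlog : 0 ≤ gridLog δ g := add_nonneg (Real.log_nonneg (one_le_one_div hδ hδ1.le))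
    (neg_nonneg.2 (Real.log_nonpos (gridWeight_pos g).le (gridWeight_le_one g)))
  have hexp : Real.exp (-(2 * n * (√(9 / (2 * n)) * √(gridLog δ g)) ^ 2 / 9)) =
      δ * gridWeight g := by
    have hsq : 2 * n * (√(9 / (2 * n)) * √(gridLog δ g)) ^ 2 / 9 = gridLog δ g := by
      rw [mul_pow, Real.sq_sqrt (by positivity), Real.sq_sqrt hlog]
      field_simp
    rw [hsq, gridLog, neg_add, neg_neg, one_div, Real.log_inv, neg_neg, Real.exp_add,
      Real.exp_log hδ, Real.exp_log (gridWeight_pos g)]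
  rw [← ENNReal.ofReal_mul hδ.le, ← hexp]
  exact measure_iUnion_deviationEvent_le hL hk hσ hσ0 (gridRadius_pos hL _) (gridRadius_pos hL _)
    (by positivity) hn (by positivity)

lemma measureReal_ne_le_of_notMem_gridEvent (hL : 1 ≤ L) (hk : 2 ≤ d (Fin.last L))
    (hσ : ∀ i, Continuous (σ i)) (hn : 0 < n)
    {S : Fin n → EuclideanSpace ℝ (Fin (d 0)) × Fin (d (Fin.last L))}
    (hS : ∀ g, S ∉ gridEvent σ ρ M δ n μ g) (hγ : 0 < γ) (A : Weights d m)
    {c : EuclideanSpace ℝ (Fin (d 0)) → Fin (d (Fin.last L))}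
    (hc : ∀ x j, network σ A x j ≤ network σ A x (c x)) :
    μ.real {z | c z.1 ≠ z.2} ≤ empiricalRampRisk γ (network σ A) S +
      excess ρ M δ n γ (dataNorm fun i => (S i).1) A := by
  have hW : 1 ≤ width d m := one_le_two.trans (hk.trans (le_width_left _))
  have hB : 0 ≤ dataNorm fun i => (S i).1 := Real.sqrt_nonneg _
  obtain ⟨g, hgγ, hγg, hA, hp, hq, hlog⟩ := exists_grid hL hn hγ hB δ M A
  have hγ' : 0 < n * (2 : ℝ) ^ g.1 := by positivity
  have hdev : ∫ z, netLoss σ (n * 2 ^ g.1) A z ∂μ ≤ _ :=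
    not_lt.1 fun hlt => hS g (Set.mem_biUnion hA hlt)
  linarith [measureReal_ne_le_integral_netLoss (μ := μ) hk hσ hγ' hc,
    empiricalRampRisk_mono hγ' hgγ (network σ A) S,
    classExcess_add_le_excess (ρ := ρ) hW hn hγ' hγg hγ hB (fun i => (gridRadius_pos hL _ i).le)
      (fun i => (gridRadius_pos hL _ i).le) hp hq hlog]

theorem generalization_bound (hL : 1 ≤ L) (hk : 2 ≤ d (Fin.last L))
    (hσ : ∀ i, LipschitzWith (ρ i) (σ i)) (hσ0 : ∀ i, σ i 0 = 0) (M : Weights d m)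
    (hδ : 0 < δ) (hδ1 : δ < 1)
    (μ : Measure (EuclideanSpace ℝ (Fin (d 0)) × Fin (d (Fin.last L)))) [IsProbabilityMeasure μ]
    (hn : 0 < n) :
    (Measure.pi fun _ : Fin n => μ)
      {S | ¬ ∀ (γ : ℝ) (_ : 0 < γ) (A : Weights d m)
          (c : EuclideanSpace ℝ (Fin (d 0)) → Fin (d (Fin.last L)))
          (_ : ∀ x j, network σ A x j ≤ network σ A x (c x)),
          μ.real {z | c z.1 ≠ z.2} ≤ empiricalRampRisk γ (network σ A) S +
            excess ρ M δ n γ (dataNorm fun i => (S i).1) A} ≤ ENNReal.ofReal δ := by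
  refine (measure_mono fun S hS => ?_).trans (measure_iUnion_le_of_forall_le_mul
    (measure_gridEvent_le (M := M) hL hk hσ hσ0 hδ hδ1 hn) (tsum_gridWeight_le_one L))
  by_contra hmem
  rw [Set.mem_iUnion, not_exists] at hmem
  exact hS fun γ hγ A c hc =>
    measureReal_ne_le_of_notMem_gridEvent hL hk (fun i => (hσ i).continuous) hn hmem hγ A hc

end Generalization

/-! ### The asymptotic form of the excess -/

section Rate

lemma norm_mulData_le_norm21 {n p q : ℕ} (A : Matrix (Fin p) (Fin q) ℝ) (Z : DataSpace n q) :
    ‖mulData A Z‖ ≤ norm21 A.transpose * ‖Z‖ := by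
  rw [mulData_eq_sum]
  refine (norm_sum_le_of_le _ fun rc _ => ?_).trans (sum_abs_mul_coordNorm_le A Z)
  rw [norm_smul, Real.norm_eq_abs]
  exact mul_le_of_le_one_right (abs_nonneg _) (norm_columnAtom_le Z rc)

lemma spectralNorm_le_norm21 {p q : ℕ} (A : Matrix (Fin p) (Fin q) ℝ) :
    spectralNorm A ≤ norm21 A.transpose := by
  have hdef : spectralNorm A = ‖(Matrix.toEuclideanLin A).toContinuousLinearMap‖ := by
    open scoped Matrix.Norms.L2Operator in
    exact Matrix.l2_opNorm_def A
  have hsingle {r : ℕ} (w : EuclideanSpace ℝ (Fin r)) :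
      ‖(WithLp.toLp 2 fun _ => w : DataSpace 1 r)‖ = ‖w‖ := by
    simp [PiLp.norm_eq_of_L2 (WithLp.toLp 2 fun _ => w : DataSpace 1 r)]
  rw [hdef]
  refine ContinuousLinearMap.opNorm_le_bound _ (norm21_nonneg _) fun z => ?_
  calc _ = ‖mulData A (WithLp.toLp 2 fun _ => z : DataSpace 1 q)‖ :=
        (hsingle (WithLp.toLp 2 (A.mulVec z))).symm
    _ ≤ norm21 A.transpose * ‖(WithLp.toLp 2 fun _ => z : DataSpace 1 q)‖ :=
        norm_mulData_le_norm21 A _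
    _ = norm21 A.transpose * ‖z‖ := by rw [hsingle]

lemma rpow_two_thirds_rpow_three_halves {x : ℝ} (hx : 0 ≤ x) :
    (x ^ (2 / 3 : ℝ)) ^ (3 / 2 : ℝ) = x := by
  rw [← Real.rpow_mul hx]
  norm_num

lemma complexitySum_rpow_eq {ι : Type*} [Fintype ι] [DecidableEq ι] {a s : ι → ℝ}
    (ha : ∀ i, 0 ≤ a i) (hs : ∀ i, 0 < s i) :
    complexitySum a s ^ (3 / 2 : ℝ) =
      (∏ i, s i) * (∑ i, a i ^ (2 / 3 : ℝ) / s i ^ (2 / 3 : ℝ)) ^ (3 / 2 : ℝ) := by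
  have hprod : 0 ≤ ∏ i, s i := Finset.prod_nonneg fun i _ => (hs i).le
  have hterm (i : ι) : (a i * ∏ j ∈ Finset.univ.erase i, s j) ^ (2 / 3 : ℝ) =
      (∏ i, s i) ^ (2 / 3 : ℝ) * (a i ^ (2 / 3 : ℝ) / s i ^ (2 / 3 : ℝ)) := by
    rw [← Real.div_rpow (ha i) (hs i).le, ← Real.mul_rpow hprod (div_nonneg (ha i) (hs i).le),
      ← Finset.mul_prod_erase Finset.univ s (Finset.mem_univ i)]
    congr 1
    have := (hs i).ne'
    field_simp
  have hsum : 0 ≤ ∑ i, a i ^ (2 / 3 : ℝ) / s i ^ (2 / 3 : ℝ) := Finset.sum_nonneg fun i _ =>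
    div_nonneg (Real.rpow_nonneg (ha i) _) (Real.rpow_nonneg (hs i).le _)
  rw [complexitySum, Finset.sum_congr rfl fun i _ => hterm i, ← Finset.mul_sum,
    Real.mul_rpow (Real.rpow_nonneg hprod _) hsum, rpow_two_thirds_rpow_three_halves hprod]

lemma complexitySum_mul_left_rpow {ι : Type*} [Fintype ι] [DecidableEq ι] {a s : ι → ℝ} {c : ℝ}
    (ha : ∀ i, 0 ≤ a i) (hs : ∀ i, 0 < s i) (hc : 0 < c) :
    complexitySum (fun i => c * a i) (fun i => c * s i) ^ (3 / 2 : ℝ) =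
      c ^ Fintype.card ι * complexitySum a s ^ (3 / 2 : ℝ) := by
  have hratio (i : ι) : (c * a i) ^ (2 / 3 : ℝ) / (c * s i) ^ (2 / 3 : ℝ) =
      a i ^ (2 / 3 : ℝ) / s i ^ (2 / 3 : ℝ) := by
    rw [Real.mul_rpow hc.le (ha i), Real.mul_rpow hc.le (hs i).le,
      mul_div_mul_left _ _ (Real.rpow_pos_of_pos hc _).ne']
  rw [complexitySum_rpow_eq (fun i => mul_nonneg hc.le (ha i)) fun i => mul_pos hc (hs i),
    complexitySum_rpow_eq ha hs, Finset.prod_mul_distrib, Finset.prod_const, Finset.card_univ,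
    mul_assoc, Finset.sum_congr rfl fun i _ => hratio i]

lemma one_add_one_div_pow_le_three (k : ℕ) : (1 + 1 / (k : ℝ)) ^ k ≤ 3 := by
  rcases Nat.eq_zero_or_pos k with rfl | hk
  · norm_num
  calc (1 + 1 / (k : ℝ)) ^ k ≤ Real.exp (1 / k) ^ k := by
        gcongr
        linarith [Real.add_one_le_exp (1 / (k : ℝ))]
    _ = Real.exp 1 := by
        rw [← Real.exp_nat_mul, mul_one_div_cancel (by positivity)]
    _ ≤ 3 := by linarith [Real.exp_one_lt_d9]

variable {L n : ℕ} {d : Fin (L + 1) → ℕ} {m : Fin L → ℕ} {ρ : Fin L → NNReal}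
  {M A : Weights d m} {δ γ B : ℝ}

lemma spectralComplexity_eq (hs : ∀ i, 0 < spectralNorm (A i)) :
    spectralComplexity ρ M A = (∏ i, (ρ i : ℝ)) *
      complexitySum (refDist M A) (fun i => spectralNorm (A i)) ^ (3 / 2 : ℝ) := by
  rw [complexitySum_rpow_eq (refDist_nonneg M A) hs, spectralComplexity, Finset.prod_mul_distrib,
    mul_assoc]
  rfl

lemma spectralNorm_le_refDist_add (M A : Weights d m) (i : Fin L) :
    spectralNorm (A i) ≤ refDist M A i + spectralNorm (M i) := by
  have hsub : spectralNorm (A i) ≤ spectralNorm (A i - M i) + spectralNorm (M i) := by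
    open scoped Matrix.Norms.L2Operator in
    exact norm_le_norm_sub_add (A i) (M i)
  have h21 := spectralNorm_le_norm21 (A i - M i)
  rw [Matrix.transpose_sub] at h21
  exact hsub.trans (add_le_add_left h21 _)

/-- The weights are so large that the reference matrices, the Lipschitz constants and the shifts
by `1 / L` in `excess` change the order of no term; for fixed `ρ` and `M` this holds as soon as
all spectral norms are large, see `eventually_largeWeights`. -/
structure LargeWeights (ρ : Fin L → NNReal) (M A : Weights d m) : Prop where
  two_le_spectralNorm : ∀ i, 2 ≤ spectralNorm (A i)
  spectralNorm_le : ∀ i, spectralNorm (A i) ≤ 2 * refDist M A i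
  two_le_mul : ∀ i, 2 ≤ ρ i * spectralNorm (A i)

lemma eventually_largeWeights (hρ : ∀ i, 0 < ρ i) (M : Weights d m) {T : Type*} {l : Filter T}
    {A : T → Weights d m} (hA : ∀ i, Tendsto (fun t => spectralNorm (A t i)) l atTop) :
    ∀ᶠ t in l, LargeWeights ρ M (A t) := by
  filter_upwards [eventually_all.2 fun i => (hA i).eventually_ge_atTop 2,
    eventually_all.2 fun i => (hA i).eventually_ge_atTop (2 * spectralNorm (M i)),
    eventually_all.2 fun i => (hA i).eventually_ge_atTop (2 / ρ i)] with t h_two h_ref h_lip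
  refine ⟨h_two, fun i => ?_, fun i => ?_⟩
  · linarith [spectralNorm_le_refDist_add M (A t) i, h_ref i]
  · exact (div_le_iff₀' (NNReal.coe_pos.2 (hρ i))).1 (h_lip i)

namespace LargeWeights

lemma spectralNorm_pos (h : LargeWeights ρ M A) (i : Fin L) : 0 < spectralNorm (A i) :=
  two_pos.trans_le (h.two_le_spectralNorm i)

lemma one_le_refDist (h : LargeWeights ρ M A) (i : Fin L) : 1 ≤ refDist M A i := by
  linarith [h.two_le_spectralNorm i, h.spectralNorm_le i]

lemma refDist_le_spectralComplexity (h : LargeWeights ρ M A) (i : Fin L) :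
    ρ i * refDist M A i ≤ spectralComplexity ρ M A := by
  have hs := h.spectralNorm_pos
  have ha := refDist_nonneg M A
  have hρs (j : Fin L) : 1 ≤ (ρ j : ℝ) * spectralNorm (A j) := one_le_two.trans (h.two_le_mul j)
  have hratio : refDist M A i / spectralNorm (A i) ≤
      (∑ j, refDist M A j ^ (2 / 3 : ℝ) / spectralNorm (A j) ^ (2 / 3 : ℝ)) ^ (3 / 2 : ℝ) := by
    have hterm (j : Fin L) : 0 ≤ refDist M A j ^ (2 / 3 : ℝ) / spectralNorm (A j) ^ (2 / 3 : ℝ) :=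
      div_nonneg (Real.rpow_nonneg (ha j) _) (Real.rpow_nonneg (hs j).le _)
    rw [← rpow_two_thirds_rpow_three_halves (div_nonneg (ha i) (hs i).le),
      Real.div_rpow (ha i) (hs i).le]
    exact Real.rpow_le_rpow (hterm i)
      (Finset.single_le_sum (fun j _ => hterm j) (Finset.mem_univ i)) (by norm_num)
  have hprod : (ρ i : ℝ) * spectralNorm (A i) ≤ ∏ j, (ρ j : ℝ) * spectralNorm (A j) := by
    rw [← Finset.mul_prod_erase Finset.univ (fun j => (ρ j : ℝ) * spectralNorm (A j))
      (Finset.mem_univ i)]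
    exact le_mul_of_one_le_right (zero_le_one.trans (hρs i))
      (Finset.one_le_prod fun j _ => hρs j)
  calc (ρ i : ℝ) * refDist M A i =
        ρ i * spectralNorm (A i) * (refDist M A i / spectralNorm (A i)) := by
        field_simp [(hs i).ne']
    _ ≤ spectralComplexity ρ M A := mul_le_mul hprod hratio (div_nonneg (ha i) (hs i).le)
        ((zero_le_one.trans (hρs i)).trans hprod)

lemma one_le_spectralComplexity (h : LargeWeights ρ M A) (hL : 1 ≤ L) :
    1 ≤ spectralComplexity ρ M A := by
  have hscale := mul_le_mul_of_nonneg_left (h.spectralNorm_le ⟨0, hL⟩) (ρ ⟨0, hL⟩).coe_nonneg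
  linarith [h.two_le_mul ⟨0, hL⟩, h.refDist_le_spectralComplexity ⟨0, hL⟩]

lemma shiftedComplexity_rpow_le (h : LargeWeights ρ M A) :
    (∏ i, (ρ i : ℝ)) * shiftedComplexity M A ^ (3 / 2 : ℝ) ≤ 3 * spectralComplexity ρ M A := by
  have ha := refDist_nonneg M A
  have hs := h.spectralNorm_pos
  have hshift {x : ℝ} (hx : 1 ≤ x) : 1 / (L : ℝ) + x ≤ (1 + 1 / L) * x := by
    linarith [le_mul_of_one_le_right (by positivity : 0 ≤ 1 / (L : ℝ)) hx]
  have hU : 0 ≤ complexitySum (refDist M A) (fun i => spectralNorm (A i)) ^ (3 / 2 : ℝ) :=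
    Real.rpow_nonneg (complexitySum_nonneg ha fun i => (hs i).le) _
  have hle : shiftedComplexity M A ^ (3 / 2 : ℝ) ≤
      3 * complexitySum (refDist M A) (fun i => spectralNorm (A i)) ^ (3 / 2 : ℝ) :=
    calc shiftedComplexity M A ^ (3 / 2 : ℝ)
        ≤ complexitySum (fun i => (1 + 1 / L) * refDist M A i)
            (fun i => (1 + 1 / L) * spectralNorm (A i)) ^ (3 / 2 : ℝ) :=
          Real.rpow_le_rpow (shiftedComplexity_nonneg M A) (complexitySum_mono
            (fun i => add_nonneg (by positivity) (ha i))
            (fun i => add_nonneg (by positivity) (hs i).le)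
            (fun i => hshift (h.one_le_refDist i))
            fun i => hshift (one_le_two.trans (h.two_le_spectralNorm i))) (by norm_num)
      _ = (1 + 1 / (L : ℝ)) ^ L *
            complexitySum (refDist M A) (fun i => spectralNorm (A i)) ^ (3 / 2 : ℝ) := by
          rw [complexitySum_mul_left_rpow ha hs (by positivity), Fintype.card_fin]
      _ ≤ 3 * complexitySum (refDist M A) (fun i => spectralNorm (A i)) ^ (3 / 2 : ℝ) :=
          mul_le_mul_of_nonneg_right (one_add_one_div_pow_le_three L) hU
  rw [spectralComplexity_eq hs, mul_left_comm]
  exact mul_le_mul_of_nonneg_left hle (Finset.prod_nonneg fun i _ => (ρ i).coe_nonneg)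

end LargeWeights

/-- The part of the bound for `confidenceLog` that depends on `ρ` and `δ` only. -/
def logConstant (ρ : Fin L → NNReal) (δ : ℝ) : ℝ :=
  Real.log (1 / δ) + 7 + ∑ i, (4 * Real.log (2 + L) - 4 * Real.log (ρ i) + 2)

lemma log_two_add_mul_le {c x : ℝ} (hc : 0 ≤ c) (hx : 1 ≤ x) :
    Real.log (2 + c * x) ≤ Real.log (2 + c) + Real.log x := by
  rw [← Real.log_mul (by positivity) (by positivity)]
  exact Real.log_le_log (by positivity) (by nlinarith)

lemma abs_log_div_le {x y : ℝ} (hx : 1 ≤ x) (hy : 0 < y) :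
    |Real.log (x / y)| ≤ Real.log x + |Real.log y| := by
  rw [Real.log_div (by positivity) hy.ne']
  exact (abs_sub _ _).trans_eq (by rw [abs_of_nonneg (Real.log_nonneg hx)])

lemma LargeWeights.log_refDist_le (h : LargeWeights ρ M A) (hρ : ∀ i, 0 < ρ i) (i : Fin L) :
    Real.log (refDist M A i) ≤ Real.log (spectralComplexity ρ M A) - Real.log (ρ i) := by
  have hρi : (0 : ℝ) < ρ i := hρ i
  have ha : 0 < refDist M A i := zero_lt_one.trans_le (h.one_le_refDist i)
  have hlog := Real.log_le_log (by positivity) (h.refDist_le_spectralComplexity i)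
  rw [Real.log_mul hρi.ne' ha.ne'] at hlog
  linarith

lemma LargeWeights.log_spectralNorm_le (h : LargeWeights ρ M A) (i : Fin L) :
    Real.log (spectralNorm (A i)) ≤ 1 + Real.log (refDist M A i) := by
  have ha : 0 < refDist M A i := zero_lt_one.trans_le (h.one_le_refDist i)
  have hlog := Real.log_le_log (h.spectralNorm_pos i) (h.spectralNorm_le i)
  rw [Real.log_mul two_ne_zero ha.ne'] at hlog
  linarith [Real.log_two_lt_d9]

lemma log_natCast_le_logFactor (hB : 1 ≤ B) (hR : 1 ≤ spectralComplexity ρ M A) :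
    Real.log n ≤ logFactor ρ M n γ B A := by
  rw [logFactor]
  linarith [abs_nonneg (Real.log γ), Real.log_nonneg hB, Real.log_nonneg hR]

lemma LargeWeights.confidenceLog_le (h : LargeWeights ρ M A) (hρ : ∀ i, 0 < ρ i) (hL : 1 ≤ L)
    (hn : 1 ≤ n) (hγ : 0 < γ) (hB : 1 ≤ B) :
    confidenceLog M δ n γ B A ≤ logConstant ρ δ + (2 + 4 * L) * logFactor ρ M n γ B A := by
  have hn' : (1 : ℝ) ≤ n := by exact_mod_cast hn
  have hlogn : 0 ≤ Real.log n := Real.log_nonneg hn'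
  have hlogB : 0 ≤ Real.log B := Real.log_nonneg hB
  have hlogR : 0 ≤ Real.log (spectralComplexity ρ M A) :=
    Real.log_nonneg (h.one_le_spectralComplexity hL)
  have hdata : Real.log (2 + B) ≤ 2 + Real.log B := by
    have hmul := log_two_add_mul_le zero_le_one hB
    rw [one_mul] at hmul
    linarith [Real.log_le_sub_one_of_pos (by norm_num : (0 : ℝ) < 2 + 1)]
  have hdist (i : Fin L) : Real.log (2 + L * refDist M A i) ≤
      Real.log (2 + L) + (Real.log (spectralComplexity ρ M A) - Real.log (ρ i)) :=
    (log_two_add_mul_le (Nat.cast_nonneg L) (h.one_le_refDist i)).trans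
      (by linarith [h.log_refDist_le hρ i])
  have hspec (i : Fin L) : Real.log (2 + L * spectralNorm (A i)) ≤
      Real.log (2 + L) + (1 + (Real.log (spectralComplexity ρ M A) - Real.log (ρ i))) :=
    (log_two_add_mul_le (Nat.cast_nonneg L)
      (one_le_two.trans (h.two_le_spectralNorm i))).trans
      (by linarith [h.log_refDist_le hρ i, h.log_spectralNorm_le i])
  have hdist_sum := Finset.sum_le_sum fun i (_ : i ∈ Finset.univ) => hdist i
  have hspec_sum := Finset.sum_le_sum fun i (_ : i ∈ Finset.univ) => hspec i
  have hrest : 0 ≤ L * (Real.log n + |Real.log γ| + Real.log B) := by positivity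
  rw [confidenceLog, logConstant, logFactor]
  simp only [Finset.sum_add_distrib, Finset.sum_sub_distrib, Finset.sum_const, Finset.card_univ,
    Fintype.card_fin, nsmul_eq_mul, mul_one, ← Finset.mul_sum] at hdist_sum hspec_sum ⊢
  nlinarith [abs_nonneg (Real.log γ), abs_log_div_le hn' hγ, Real.log_two_lt_d9]

lemma eight_div_le_sqrt_mul {D Λ : ℝ} (hD : 0 < D) (hn : 1 ≤ n) (hΛ : 8 / √D ≤ Λ) :
    8 / (n : ℝ) ≤ √(D / n) * Λ := by
  have hn' : (1 : ℝ) ≤ n := by exact_mod_cast hn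
  have hsqrt : √(n : ℝ) ≤ n := Real.sqrt_le_iff.2 ⟨by positivity, by nlinarith⟩
  have : 0 < √D := Real.sqrt_pos.2 hD
  calc 8 / (n : ℝ) ≤ 8 / √(n : ℝ) := by gcongr
    _ = √(D / n) * (8 / √D) := by
        rw [Real.sqrt_div hD.le]
        field_simp
    _ ≤ √(D / n) * Λ := by gcongr

lemma LargeWeights.complexity_term_le (h : LargeWeights ρ M A) (hW : 2 ≤ width d m)
    (hγ : 0 < γ) (hB : 1 ≤ B) :
    144 * Real.log n * Real.log (2 * width d m) / (γ * n) * (∏ i, (ρ i : ℝ)) * (1 + B) *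
        shiftedComplexity M A ^ (3 / 2 : ℝ) ≤
      1728 * (B * spectralComplexity ρ M A / (γ * n) * Real.log (width d m) * Real.log n) := by
  have hW' : (2 : ℝ) ≤ width d m := by exact_mod_cast hW
  have : 0 ≤ Real.log n := Real.log_natCast_nonneg n
  have : 0 ≤ Real.log (2 * width d m) := Real.log_nonneg (by linarith)
  have hlogW : Real.log (2 * width d m) ≤ 2 * Real.log (width d m) := by
    rw [Real.log_mul two_ne_zero (by positivity)]
    linarith [Real.log_le_log two_pos hW']
  have hU : 0 ≤ (∏ i, (ρ i : ℝ)) * shiftedComplexity M A ^ (3 / 2 : ℝ) :=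
    mul_nonneg (Finset.prod_nonneg fun i _ => (ρ i).coe_nonneg)
      (Real.rpow_nonneg (shiftedComplexity_nonneg M A) _)
  calc _ = 144 * Real.log n * Real.log (2 * width d m) / (γ * n) * (1 + B) *
        ((∏ i, (ρ i : ℝ)) * shiftedComplexity M A ^ (3 / 2 : ℝ)) := by ring
    _ ≤ 144 * Real.log n * (2 * Real.log (width d m)) / (γ * n) * (B + B) *
        (3 * spectralComplexity ρ M A) := by
        refine mul_le_mul ?_ h.shiftedComplexity_rpow_le hU (by positivity)
        gcongr
    _ = _ := by ring

lemma sqrt_mul_sqrt_le_sqrt_mul {D Λ K c ℓ : ℝ} (hD : 0 < D) (hΛ : 1 ≤ Λ)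
    (hℓ : ℓ ≤ K + c * Λ) (hK : 9 / 2 * (|K| + c) / D ≤ Λ) :
    √(9 / (2 * n)) * √ℓ ≤ √(D / n) * Λ := by
  have hℓ' : ℓ ≤ (|K| + c) * Λ := by
    linarith [le_abs_self K, le_mul_of_one_le_right (abs_nonneg K) hΛ]
  have hKD : 9 / 2 * (|K| + c) ≤ Λ * D := (div_le_iff₀ hD).1 hK
  rw [← Real.sqrt_mul (by positivity)]
  refine Real.sqrt_le_iff.2 ⟨by positivity, ?_⟩
  rw [mul_pow, Real.sq_sqrt (by positivity)]
  calc 9 / (2 * (n : ℝ)) * ℓ ≤ 9 / (2 * n) * ((|K| + c) * Λ) := by gcongr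
    _ = 9 / 2 * (|K| + c) * Λ / n := by ring
    _ ≤ Λ * D * Λ / n := by gcongr
    _ = D / n * Λ ^ 2 := by ring

lemma LargeWeights.excess_le (h : LargeWeights ρ M A) (hρ : ∀ i, 0 < ρ i) (hL : 1 ≤ L)
    (hW : 2 ≤ width d m) (hδ : 0 < δ) (hδ1 : δ < 1) (hn : 1 ≤ n) (hγ : 0 < γ) (hB : 1 ≤ B)
    (hlog_one : 1 ≤ Real.log n) (hlog_sqrt : 8 / √(Real.log (1 / δ)) ≤ Real.log n)
    (hlog_const : 9 / 2 * (|logConstant ρ δ| + (2 + 4 * L)) / Real.log (1 / δ) ≤ Real.log n) :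
    excess ρ M δ n γ B A ≤ 1728 * (rate ρ M δ n γ B A * logFactor ρ M n γ B A) := by
  have hD : 0 < Real.log (1 / δ) := Real.log_pos (one_lt_one_div hδ hδ1)
  have hR := h.one_le_spectralComplexity hL
  have hlogn : Real.log n ≤ logFactor ρ M n γ B A := log_natCast_le_logFactor hB hR
  have : 0 ≤ Real.log (width d m) := Real.log_natCast_nonneg _
  have hbias := eight_div_le_sqrt_mul hD hn (hlog_sqrt.trans hlogn)
  have hcomplexity : 144 * Real.log n * Real.log (2 * width d m) / (γ * n) *
      (∏ i, (ρ i : ℝ)) * (1 + B) * shiftedComplexity M A ^ (3 / 2 : ℝ) ≤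
      1728 * (B * spectralComplexity ρ M A / (γ * n) * Real.log (width d m) *
        logFactor ρ M n γ B A) :=
    (h.complexity_term_le hW hγ hB).trans (by gcongr)
  have hconfidence := sqrt_mul_sqrt_le_sqrt_mul (n := n) hD (hlog_one.trans hlogn)
    (h.confidenceLog_le (δ := δ) hρ hL hn hγ hB) (hlog_const.trans hlogn)
  have hnonneg : 0 ≤ √(Real.log (1 / δ) / n) * logFactor ρ M n γ B A :=
    mul_nonneg (Real.sqrt_nonneg _) (zero_le_one.trans (hlog_one.trans hlogn))
  rw [excess_eq, rate]
  linarith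

lemma eventually_excess_le (hρ : ∀ i, 0 < ρ i) (M : Weights d m) (hL : 1 ≤ L)
    (hW : 2 ≤ width d m) (hδ : 0 < δ) (hδ1 : δ < 1) {T : Type*} {l : Filter T} {n : T → ℕ}
    {γ B : T → ℝ} {A : T → Weights d m} (hγ : ∀ t, 0 < γ t) (hn : Tendsto n l atTop)
    (hB : Tendsto B l atTop) (hA : ∀ i, Tendsto (fun t => spectralNorm (A t i)) l atTop) :
    ∀ᶠ t in l, excess ρ M δ (n t) (γ t) (B t) (A t) ≤
      1728 * (rate ρ M δ (n t) (γ t) (B t) (A t) * logFactor ρ M (n t) (γ t) (B t) (A t)) := by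
  have hlog : Tendsto (fun t => Real.log (n t)) l atTop :=
    Real.tendsto_log_atTop.comp (tendsto_natCast_atTop_atTop.comp hn)
  filter_upwards [eventually_largeWeights hρ M hA, hn.eventually_ge_atTop 1,
    hB.eventually_ge_atTop 1, hlog.eventually_ge_atTop 1,
    hlog.eventually_ge_atTop (8 / √(Real.log (1 / δ))),
    hlog.eventually_ge_atTop (9 / 2 * (|logConstant ρ δ| + (2 + 4 * L)) / Real.log (1 / δ))]
    with t h_large h_n h_B h_one h_sqrt h_const
  exact h_large.excess_le hρ hL hW hδ hδ1 h_n (hγ t) h_B h_one h_sqrt h_const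

end Rate

end SpectralMargin

end

theorem mainTheorem1 :
    ∃ C : ℝ, 0 < C ∧
      ∀ (L : ℕ) (_ : 1 ≤ L) (d : Fin (L + 1) → ℕ) (m : Fin L → ℕ)
        (_ : 2 ≤ d (Fin.last L))
        (σ : SpectralMargin.Nonlinearities d m) (ρ : Fin L → NNReal)
        (_ : ∀ i, LipschitzWith (ρ i) (σ i)) (_ : ∀ i, σ i 0 = 0)
        (M : SpectralMargin.Weights d m) (δ : ℝ) (_ : 0 < δ) (_ : δ < 1),
        -- the bound: outside an event of probability at most `δ`, all `γ` and `A` satisfy it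
        (∀ (μ : Measure (EuclideanSpace ℝ (Fin (d 0)) × Fin (d (Fin.last L))))
            [IsProbabilityMeasure μ] (n : ℕ) (_ : 1 ≤ n),
          (Measure.pi fun _ : Fin n => μ)
            {S | ¬ ∀ (γ : ℝ) (_ : 0 < γ) (A : SpectralMargin.Weights d m)
                -- `c` is the predicted label, with any rule for breaking ties
                (c : EuclideanSpace ℝ (Fin (d 0)) → Fin (d (Fin.last L)))
                (_ : ∀ x j, SpectralMargin.network σ A x j ≤ SpectralMargin.network σ A x (c x)),
                μ.real {z | c z.1 ≠ z.2} ≤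
                  SpectralMargin.empiricalRampRisk γ (SpectralMargin.network σ A) S +
                  SpectralMargin.excess ρ M δ n γ
                    (SpectralMargin.dataNorm fun i => (S i).1) A}
            ≤ ENNReal.ofReal δ) ∧
        -- the empirical ramp risk is at most the empirical margin error
        (∀ (n : ℕ) (S : Fin n → EuclideanSpace ℝ (Fin (d 0)) × Fin (d (Fin.last L)))
            (γ : ℝ) (_ : 0 < γ) (A : SpectralMargin.Weights d m),
          SpectralMargin.empiricalRampRisk γ (SpectralMargin.network σ A) S ≤
            SpectralMargin.empiricalMarginError γ (SpectralMargin.network σ A) S) ∧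
        -- the excess is the stated rate up to a logarithmic factor
        ((∀ i, 0 < ρ i) →
          ∀ (n : ℕ → ℕ) (γ : ℕ → ℝ) (X : ∀ t, Fin (n t) → EuclideanSpace ℝ (Fin (d 0)))
            (A : ℕ → SpectralMargin.Weights d m),
            (∀ t, 0 < γ t) →
            Tendsto n atTop atTop →
            Tendsto (fun t => SpectralMargin.dataNorm (X t)) atTop atTop →
            (∀ i, Tendsto (fun t => SpectralMargin.spectralNorm (A t i)) atTop atTop) →
            ∀ᶠ t in atTop,
              SpectralMargin.excess ρ M δ (n t) (γ t) (SpectralMargin.dataNorm (X t)) (A t) ≤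
                C * (SpectralMargin.rate ρ M δ (n t) (γ t)
                    (SpectralMargin.dataNorm (X t)) (A t) *
                  SpectralMargin.logFactor ρ M (n t) (γ t)
                    (SpectralMargin.dataNorm (X t)) (A t))) := by
  refine ⟨1728, by norm_num, fun L hL d m hk σ ρ hσ hσ0 M δ hδ hδ1 => ⟨?_, ?_, ?_⟩⟩
  · intro μ _ n hn
    exact SpectralMargin.generalization_bound hL hk hσ hσ0 M hδ hδ1 μ hn
  · intro n S γ hγ A
    exact SpectralMargin.empiricalRampRisk_le_empiricalMarginError hγ _ S
  · intro hρ n γ X A hγ hn hX hA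
    exact SpectralMargin.eventually_excess_le hρ M hL
      (hk.trans (SpectralMargin.le_width_left _)) hδ hδ1 hγ hn hX hA
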